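/- Setting. Let $\mathsf X\subseteq\mathbb R^d$ be open and let $K\subseteq\mathsf X$ be nonempty, compact and convex. Let $f:\mathsf X\to\mathbb R$ be continuously differentiable and let $g:\mathsf X\to\mathbb R$ be locally Lipschitz, bounded from below and Clarke regular (all one-sided directional derivatives exist and equal the generalized directional derivative). Let $\gamma_k>0$ ($k\ge1$) satisfy $\sum_k\gamma_k=\infty$ and $\gamma_k\to0$. Let $(\mathsf Z,\mathcal Z)$ be a measurable space and, for $x\in\mathsf X$, let $M_x$ be a Markov kernel on $\mathsf Z$ with invariant probability measure $\pi_x$. Let $\Phi:K\times\mathsf Z\to\mathbb R^d$ be measurable with $\Phi(x,\cdot)$ $\pi_x$-integrable and $\nabla f(x)=\int_{\mathsf Z}\Phi(x,z)\,\pi_x(\mathrm dz)$ for all $x\in K$. For $V:\mathsf Z\to[1,\infty)$ measurable put $\|h\|_V=\sup_z\|h(z)\|/V(z)$ and, for a finite signed measure $\mu$, $\|\mu\|_V=\sup\{\mu(h): h:\mathsf Z\to\mathbb R \text{ measurable},\ \|h\|_V\le1,\ \mu(h)\text{ well defined}\}$; put $D_V(x,x')=\sup_z\|M_x(z,\cdot)-M_{x'}(z,\cdot)\|_V/V(z)$.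 Let $W:\mathsf Z\to[1,\infty)$ be measurable and assume: (B1) $\sup_{x\in K}\|\Phi(x,\cdot)\|_{W^{1/2}}<\infty$; there are $\lambda\in[0,1)$ and $b<\infty$ with $\sup_{x\in K}M_xW\le\lambda W+b$; and for every $\ell\in(0,1]$ there are $C<\infty$ and $\rho\in(0,1)$ with $\sup_{x\in K}\|M_x^n(z,\cdot)-\pi_x\|_{W^\ell}\le C\rho^nW^\ell(z)$ for all $z\in\mathsf Z$ and $n\ge0$. (B2) There is $C<\infty$ with $\|\Phi(x,\cdot)-\Phi(x',\cdot)\|_{W^{1/2}}+D_{W^{1/2}}(x,x')\le C\|x-x'\|$ for all $x,x'\in K$. On a probability space with a filtration $(\mathcal F_k)_{k\ge0}$, let $(x_k)_{k\ge0}$ and $(z_k)_{k\ge1}$ be adapted, with $x_0\in K$, such that for every $k\ge1$ the conditional law of $z_{k+1}$ given $\mathcal F_k$ is $M_{x_k}(z_k,\cdot)$. Write $\mathrm{prox}_{\gamma\varphi}(x)=\operatorname{argmin}_{y\in\mathsf X}\{\varphi(y)+\|y-x\|^2/(2\gamma)\}$ (a set), $\Pi_K$ for the projection onto $K$, and $\mathbb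 I_K$ for the indicator function of $K$ ($0$ on $K$, $+\infty$ elsewhere). Suppose that either $$x_k\in\mathrm{prox}_{\gamma_k(g+\mathbb I_K)}\bigl(x_{k-1}-\gamma_k\Phi(x_{k-1},z_k)\bigr)\quad\text{for all }k\ge1,$$ or $$x_k\in\Pi_K\bigl(\mathrm{prox}_{\gamma_kg}(x_{k-1}-\gamma_k\Phi(x_{k-1},z_k))\bigr)\quad\text{for all }k\ge1.$$ Proposition. Suppose that $\mathbb E[W(z_1)]<\infty$, $\sum_k|\gamma_{k-1}-\gamma_k|<\infty$ and $\sum_k\gamma_k^2<\infty$. Let $\delta_k=\Phi(x_{k-1},z_k)-\nabla f(x_{k-1})$ for $k\ge1$. Then, almost surely, the gradient noise can be decomposed as $\delta_k=e_k+r_k$ ($k\ge1$) with $\|r_k\|\to0$ and $\sum_{k\ge1}\gamma_ke_k$ convergent; indeed, almost surely, the series $\sum_{k\ge1}\gamma_k\delta_k$ converges. -/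

import Mathlib

open MeasureTheory ProbabilityTheory Filter Topology Set
open scoped ENNReal

noncomputable section

namespace ProxSGD

/-! ### Nonsmooth analysis: generalized directional derivative, regularity, prox, projection -/

section Analysis

variable {E : Type*} [NormedAddCommGroup E] [InnerProductSpace ℝ E]

/-- Clarke's generalized directional derivative of `g` at `x` in the direction `h`: the upper limit
of `(g (y + t h) - g y) / t` as `y → x` and `t ↓ 0`. -/
def clarkeDeriv (g : E → ℝ) (x h : E) : ℝ :=
  limsup (fun p : E × ℝ => (g (p.1 + p.2 • h) - g p.1) / p.2) (𝓝 x ×ˢ 𝓝[>] (0 : ℝ))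

/-- `g` is (Clarke) regular at `x`: every one-sided directional derivative exists and equals the
generalized directional derivative. -/
def IsRegularAt (g : E → ℝ) (x : E) : Prop :=
  ∀ h : E, Tendsto (fun t : ℝ => (g (x + t • h) - g x) / t) (𝓝[>] 0) (𝓝 (clarkeDeriv g x h))

/-- The convex indicator function of `K`: `0` on `K` and `+∞` outside. -/
def convexIndicator (K : Set E) (x : E) : EReal :=
  open Classical in if x ∈ K then 0 else ⊤

/-- The (set-valued) proximal operator over `X` of an extended-real-valued function `φ`:
the set of minimizers over `y ∈ X` of `φ y + ‖y - x‖² / (2 γ)`. -/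
def prox (X : Set E) (γ : ℝ) (φ : E → EReal) (x : E) : Set E :=
  {y | y ∈ X ∧ ∀ y' ∈ X, φ y + (((2 * γ)⁻¹ * ‖y - x‖ ^ 2 : ℝ) : EReal) ≤
    φ y' + (((2 * γ)⁻¹ * ‖y' - x‖ ^ 2 : ℝ) : EReal)}

/-- The projection of a set `A` onto `K`: all points of `K` that are nearest to some `a ∈ A`. -/
def projSet (K A : Set E) : Set E :=
  {p | ∃ a ∈ A, p ∈ K ∧ ∀ q ∈ K, ‖a - p‖ ≤ ‖a - q‖}

/-- The composite objective `f + g` on the open set `X`: `f` is continuously differentiable and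
`g` is locally Lipschitz, bounded from below and regular on `X`. -/
structure CompositeObjective (X : Set E) (f g : E → ℝ) : Prop where
  isOpen : IsOpen X
  contDiff : ContDiffOn ℝ 1 f X
  locallyLipschitz : LocallyLipschitzOn X g
  bddBelow : BddBelow (g '' X)
  regular : ∀ x ∈ X, IsRegularAt g x

/-- Positive step sizes `γ 1, γ 2, …` with divergent sum and limit zero. -/
structure StepSizes (γ : ℕ → ℝ) : Prop where
  pos : ∀ k, 1 ≤ k → 0 < γ k
  sum_diverges : Tendsto (fun n : ℕ => ∑ k ∈ Finset.Icc 1 n, γ k) atTop atTop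
  tendsto_zero : Tendsto γ atTop (𝓝 0)

/-- The series `∑_{k ≥ 1} v k` converges, i.e. its partial sums have a limit. -/
def SeriesConverges (v : ℕ → E) : Prop :=
  ∃ s : E, Tendsto (fun n : ℕ => ∑ k ∈ Finset.Icc 1 n, v k) atTop (𝓝 s)

/-- The noise condition: `δ k = e k + r k` for `k ≥ 1`, where `‖r k‖ → 0` and the series
`∑_{k ≥ 1} γ k • e k` converges. -/
def NoiseCondition (γ : ℕ → ℝ) (δ : ℕ → E) : Prop :=
  ∃ e r : ℕ → E, (∀ k, 1 ≤ k → δ k = e k + r k) ∧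
    Tendsto (fun k => ‖r k‖) atTop (𝓝 0) ∧ SeriesConverges (fun k => γ k • e k)

/-- First projected scheme: `x_k ∈ prox_{γ_k (g + 𝕀_K)} (x_{k-1} - γ_k H_k)` for `k ≥ 1`. -/
def IndicatorProxScheme (X K : Set E) (g : E → ℝ) (γ : ℕ → ℝ) (x H : ℕ → E) : Prop :=
  ∀ k : ℕ, x (k + 1) ∈ prox X (γ (k + 1)) (fun y => (g y : EReal) + convexIndicator K y)
    (x k - γ (k + 1) • H (k + 1))

/-- Second projected scheme: `x_k ∈ Π_K (prox_{γ_k g} (x_{k-1} - γ_k H_k))` for `k ≥ 1`. -/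
def ProjectedProxScheme (X K : Set E) (g : E → ℝ) (γ : ℕ → ℝ) (x H : ℕ → E) : Prop :=
  ∀ k : ℕ, x (k + 1) ∈ projSet K (prox X (γ (k + 1)) (fun y => (g y : EReal))
    (x k - γ (k + 1) • H (k + 1)))

end Analysis

/-! ### Weighted norms and families of Markov kernels -/

section Kernels

variable {Z : Type*}

/-- The `W`-norm `sup_z ‖h z‖ / W z`, with values in `[0, ∞]`. -/
def wNorm {G : Type*} [NormedAddCommGroup G] (W : Z → ℝ) (h : Z → G) : ℝ≥0∞ :=
  ⨆ z, ‖h z‖ₑ / ENNReal.ofReal (W z)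

variable [MeasurableSpace Z]

/-- The `W`-variation `‖μ - ν‖_W` of the signed measure `μ - ν` (`μ`, `ν` finite measures):
the supremum of `(μ - ν)(h) = μ h - ν h` over all measurable real `h` with `W`-norm at most `1`
for which these integrals are defined. The bounded `h` alone already give the total mass of `W`
under `|μ - ν|`, which is the value `∞` if that mass is infinite. -/
def wVariation (W : Z → ℝ) (μ ν : Measure Z) : ℝ≥0∞ :=
  ⨆ (h : Z → ℝ) (_ : Measurable h) (_ : wNorm W h ≤ 1) (_ : Integrable h μ) (_ : Integrable h ν),
    ENNReal.ofReal (∫ z, h z ∂μ - ∫ z, h z ∂ν)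

/-- The `W`-variation `sup_z ‖P(z,·) - Q(z,·)‖_W / W z` between two kernels. -/
def kernelWVariation (W : Z → ℝ) (P Q : Kernel Z Z) : ℝ≥0∞ :=
  ⨆ z, wVariation W (P z) (Q z) / ENNReal.ofReal (W z)

variable {E : Type*} [NormedAddCommGroup E]

/-- Uniform-in-`x ∈ K` geometric ergodicity of the kernels `M x` towards `π x`, with the weight
function `W`: `Φ x` is uniformly bounded in `W^{1/2}`-norm, `W` satisfies a uniform drift
condition, and for all `ℓ ∈ (0,1]` the iterates `(M x)^n` (the `n`-fold composition) converge
geometrically to `π x` in `W^ℓ`-variation. -/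
structure UniformlyErgodic (K : Set E) (Φ : E → Z → E) (M : E → Kernel Z Z) (π : E → Measure Z)
    (W : Z → ℝ) : Prop where
  measurable_weight : Measurable W
  one_le_weight : ∀ z, 1 ≤ W z
  gradient_bound : ⨆ x ∈ K, wNorm (fun z => W z ^ (1 / 2 : ℝ)) (Φ x) < ⊤
  drift : ∃ lam b : ℝ, 0 ≤ lam ∧ lam < 1 ∧ ∀ z,
    ⨆ x ∈ K, ∫⁻ y, ENNReal.ofReal (W y) ∂(M x z) ≤ ENNReal.ofReal (lam * W z + b)
  ergodic : ∀ ℓ : ℝ, 0 < ℓ → ℓ ≤ 1 → ∃ C ρ : ℝ, 0 < ρ ∧ ρ < 1 ∧ ∀ (n : ℕ) (z : Z),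
    ⨆ x ∈ K, wVariation (fun y => W y ^ ℓ) ((M x ^ n) z) (π x) ≤
      ENNReal.ofReal (C * ρ ^ n * W z ^ ℓ)

/-- Lipschitz dependence on `x ∈ K` of `Φ x` and of the kernels `M x`, in `W^{1/2}`-norm and
`W^{1/2}`-variation. -/
def LipschitzInParameter (K : Set E) (Φ : E → Z → E) (M : E → Kernel Z Z) (W : Z → ℝ) : Prop :=
  ∃ C : ℝ, ∀ x ∈ K, ∀ x' ∈ K,
    wNorm (fun z => W z ^ (1 / 2 : ℝ)) (fun z => Φ x z - Φ x' z) +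
      kernelWVariation (fun z => W z ^ (1 / 2 : ℝ)) (M x) (M x') ≤ ENNReal.ofReal (C * ‖x - x'‖)

/-- The state-dependent Markovian dynamic: with respect to the filtration `ℱ`, to which the
parameters `x` and the samples `z 1, z 2, …` are adapted, the conditional law of `z (k + 1)`
given the past `ℱ k` is `M (x k) (z k, ·)`. -/
structure MarkovianDynamic {Ω : Type*} [MeasurableSpace Ω] [MeasurableSpace E] (P : Measure Ω)
    (ℱ : Filtration ℕ ‹MeasurableSpace Ω›) (M : E → Kernel Z Z) (x : ℕ → Ω → E) (z : ℕ → Ω → Z) :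
    Prop where
  measurable_param : ∀ k, Measurable[ℱ k] (x k)
  measurable_sample : ∀ k, 1 ≤ k → Measurable[ℱ k] (z k)
  transition : ∀ k, 1 ≤ k → ∀ A : Set Z, MeasurableSet A →
    P⟦z (k + 1) ⁻¹' A | ℱ k⟧ =ᵐ[P] fun ω => (M (x k ω) (z k ω)).real A

end Kernels

end ProxSGD

end

/-!
Fix a coordinate `φ` of `Φ`. By geometric ergodicity `u x = ∑ₙ ((M x)ⁿ (φ x) - π x (φ x))` solves
the Poisson equation `u x - M x (u x) = φ x - π x (φ x)`, and it is dominated by `W^{1/2}` and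
Lipschitz in `x` with respect to `W^{1/2}`. With `v x = M x (u x)` and `x = x_{k-1}`, the noise is
the sum of `u x (z_k) - v x (z_{k-1})` and `v x (z_{k-1}) - v x (z_k)`. The second part,
multiplied by `γ_k`, is summed by parts: it splits into a telescoping term, a term with the factor
`γ_{k-1} - γ_k`, and the change `γ_k (v x_k (z_k) - v x_{k-1} (z_k))` of `v` along a step.

The drift condition bounds `E[W(z_k)]` uniformly in `k`. Hence the first part gives martingale
differences whose variances are at most a constant times `γ_k²`, and their series converges almost
surely; the step-size term is summable by the bounded variation of `γ`. A proximal step moves the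
iterate by at most a constant times `γ_k W(z_k)^{1/2}`, so the last term is of order
`γ_k² W(z_k)`, which is summable in expectation.
-/

noncomputable section

namespace ProxSGD

section WeightedFunctions

variable {Z : Type*}

lemma norm_le_of_wNorm_le {G : Type*} [NormedAddCommGroup G] {V : Z → ℝ} {h : Z → G} {c : ℝ}
    {z : Z} (hV : 0 < V z) (hc : 0 ≤ c) (hh : wNorm V h ≤ ENNReal.ofReal c) : ‖h z‖ ≤ c * V z := by
  have hz : ‖h z‖ₑ / ENNReal.ofReal (V z) ≤ ENNReal.ofReal c :=
    (le_iSup (fun z => ‖h z‖ₑ / ENNReal.ofReal (V z)) z).trans hh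
  rw [ENNReal.div_le_iff (by simpa using hV) ENNReal.ofReal_ne_top, ← ENNReal.ofReal_mul hc,
    ← ofReal_norm] at hz
  exact (ENNReal.ofReal_le_ofReal_iff (by positivity)).1 hz

lemma wNorm_le_one {G : Type*} [NormedAddCommGroup G] {V : Z → ℝ} {h : Z → G}
    (hh : ∀ z, ‖h z‖ ≤ V z) : wNorm V h ≤ 1 :=
  iSup_le fun z => ENNReal.div_le_of_le_mul <| by
    rw [one_mul, ← ofReal_norm]
    exact ENNReal.ofReal_le_ofReal (hh z)

variable [MeasurableSpace Z]

/-- `h` is a measurable function whose `V`-norm is at most `c`. -/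
structure IsDominated (V : Z → ℝ) (c : ℝ) (h : Z → ℝ) : Prop where
  nonneg : 0 ≤ c
  measurable : Measurable h
  abs_le : ∀ z, |h z| ≤ c * V z

namespace IsDominated

variable {V h h' : Z → ℝ} {c c' : ℝ} {ν : Measure Z}

lemma const (hV : ∀ z, 1 ≤ V z) {a : ℝ} (ha : |a| ≤ c) : IsDominated V c fun _ => a where
  nonneg := (abs_nonneg a).trans ha
  measurable := measurable_const
  abs_le z := ha.trans (le_mul_of_one_le_right ((abs_nonneg a).trans ha) (hV z))

lemma sub (hh : IsDominated V c h) (hh' : IsDominated V c' h') :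
    IsDominated V (c + c') fun z => h z - h' z where
  nonneg := add_nonneg hh.nonneg hh'.nonneg
  measurable := hh.measurable.sub hh'.measurable
  abs_le z := (abs_sub _ _).trans (by linarith [hh.abs_le z, hh'.abs_le z])

lemma add (hh : IsDominated V c h) (hh' : IsDominated V c' h') :
    IsDominated V (c + c') fun z => h z + h' z where
  nonneg := add_nonneg hh.nonneg hh'.nonneg
  measurable := hh.measurable.add hh'.measurable
  abs_le z := (abs_add_le _ _).trans (by linarith [hh.abs_le z, hh'.abs_le z])

lemma integrable (hh : IsDominated V c h) (hV : Integrable V ν) : Integrable h ν :=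
  (hV.const_mul c).mono' hh.measurable.aestronglyMeasurable (ae_of_all _ hh.abs_le)

lemma abs_integral_le (hh : IsDominated V c h) (hV : Integrable V ν) :
    |∫ z, h z ∂ν| ≤ c * ∫ z, V z ∂ν := by
  rw [← integral_const_mul]
  exact norm_integral_le_of_norm_le (f := h) (hV.const_mul c) (ae_of_all _ hh.abs_le)

end IsDominated

end WeightedFunctions

section WeightedVariation

variable {Z : Type*} [MeasurableSpace Z] {V : Z → ℝ} {μ ν : Measure Z} {r : ℝ}

lemma wVariation_comm (V : Z → ℝ) (μ ν : Measure Z) : wVariation V μ ν = wVariation V ν μ := by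
  have hle : ∀ μ ν : Measure Z, wVariation V μ ν ≤ wVariation V ν μ := fun μ ν =>
    iSup_le fun h => iSup_le fun hm => iSup_le fun hV => iSup_le fun hμ => iSup_le fun hν =>
      le_iSup_of_le (-h) <| le_iSup_of_le hm.neg <| le_iSup_of_le (by simpa [wNorm] using hV) <|
        le_iSup_of_le hν.neg <| le_iSup_of_le hμ.neg <| ENNReal.ofReal_le_ofReal <| by
          simp only [Pi.neg_apply, integral_neg]
          linarith
  exact le_antisymm (hle μ ν) (hle ν μ)

lemma integral_sub_integral_le_of_wVariation_le (hr : 0 ≤ r)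
    (hvar : wVariation V μ ν ≤ ENNReal.ofReal r) {φ : Z → ℝ} (hm : Measurable φ)
    (hφ : ∀ z, |φ z| ≤ V z) (hμ : Integrable φ μ) (hν : Integrable φ ν) :
    ∫ z, φ z ∂μ - ∫ z, φ z ∂ν ≤ r := by
  have hle : ENNReal.ofReal (∫ z, φ z ∂μ - ∫ z, φ z ∂ν) ≤ wVariation V μ ν :=
    le_iSup_of_le φ <| le_iSup_of_le hm <| le_iSup_of_le (wNorm_le_one hφ) <|
      le_iSup_of_le hμ <| le_iSup_of_le hν le_rfl
  exact (ENNReal.ofReal_le_ofReal_iff hr).1 (hle.trans hvar)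

lemma IsDominated.abs_integral_sub_integral_le {φ : Z → ℝ} {c : ℝ} (hφ : IsDominated V c φ)
    (hr : 0 ≤ r) (hvar : wVariation V μ ν ≤ ENNReal.ofReal r) (hμ : Integrable φ μ)
    (hν : Integrable φ ν) : |∫ z, φ z ∂μ - ∫ z, φ z ∂ν| ≤ c * r := by
  rcases hφ.nonneg.eq_or_lt with rfl | hc
  · have hzero : φ = fun _ => 0 := by
      ext z
      simpa using hφ.abs_le z
    simp [hzero]
  have hscaled : ∀ a : ℝ, |a| = c⁻¹ → a * (∫ z, φ z ∂μ - ∫ z, φ z ∂ν) ≤ r := fun a ha => by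
    rw [mul_sub, ← integral_const_mul, ← integral_const_mul]
    refine integral_sub_integral_le_of_wVariation_le hr hvar (hφ.measurable.const_mul a)
      (fun z => ?_) (hμ.const_mul a) (hν.const_mul a)
    rw [abs_mul, ha, inv_mul_le_iff₀ hc]
    exact hφ.abs_le z
  have hc' : |c⁻¹| = c⁻¹ := abs_of_pos (inv_pos.2 hc)
  have hupper := hscaled c⁻¹ hc'
  have hlower := hscaled (-c⁻¹) (by rw [abs_neg, hc'])
  rw [neg_mul, ← mul_neg] at hlower
  rw [inv_mul_le_iff₀ hc] at hupper hlower
  exact abs_le'.2 ⟨hupper, hlower⟩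

lemma integrable_of_integral_min_le [IsFiniteMeasure μ] (hm : Measurable V) (hV : ∀ z, 0 ≤ V z)
    {B : ℝ} (hB : ∀ n : ℕ, ∫ z, min (V z) n ∂μ ≤ B) : Integrable V μ ∧ ∫ z, V z ∂μ ≤ B := by
  have hmin_nonneg : ∀ (n : ℕ) z, 0 ≤ min (V z) n := fun n z => le_min (hV z) n.cast_nonneg
  have hmin_integrable : ∀ n : ℕ, Integrable (fun z => min (V z) (n : ℝ)) μ := fun n =>
    Integrable.of_bound (hm.min measurable_const).aestronglyMeasurable n (ae_of_all _ fun z => by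
      rw [Real.norm_of_nonneg (hmin_nonneg n z)]
      exact min_le_right _ _)
  have hsup : ∀ z, ENNReal.ofReal (V z) = ⨆ n : ℕ, ENNReal.ofReal (min (V z) n) := fun z => by
    refine le_antisymm ?_ (iSup_le fun n => ENNReal.ofReal_le_ofReal (min_le_left _ _))
    obtain ⟨n, hn⟩ := exists_nat_ge (V z)
    exact le_iSup_of_le n (by rw [min_eq_left hn])
  have hlintegral : ∫⁻ z, ENNReal.ofReal (V z) ∂μ ≤ ENNReal.ofReal B := by
    simp_rw [hsup]
    rw [lintegral_iSup (fun n => (hm.min measurable_const).ennreal_ofReal)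
      (fun a b hab z => ENNReal.ofReal_le_ofReal (min_le_min le_rfl (by exact_mod_cast hab)))]
    refine iSup_le fun n => ?_
    rw [← ofReal_integral_eq_lintegral_ofReal (hmin_integrable n) (ae_of_all _ (hmin_nonneg n))]
    exact ENNReal.ofReal_le_ofReal (hB n)
  have hV_integrable : Integrable V μ := by
    refine ⟨hm.aestronglyMeasurable, ?_⟩
    rw [hasFiniteIntegral_iff_ofReal (ae_of_all _ hV)]
    exact hlintegral.trans_lt ENNReal.ofReal_lt_top
  have hB0 : 0 ≤ B := (integral_nonneg (hmin_nonneg 0)).trans (hB 0)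
  rw [← ofReal_integral_eq_lintegral_ofReal hV_integrable (ae_of_all _ hV),
    ENNReal.ofReal_le_ofReal_iff hB0] at hlintegral
  exact ⟨hV_integrable, hlintegral⟩

lemma integrable_of_wVariation_le [IsFiniteMeasure ν] (hm : Measurable V) (hV : ∀ z, 0 ≤ V z)
    (hr : 0 ≤ r) (hvar : wVariation V μ ν ≤ ENNReal.ofReal r) (hμ : Integrable V μ) :
    Integrable V ν ∧ ∫ z, V z ∂ν ≤ ∫ z, V z ∂μ + r := by
  refine integrable_of_integral_min_le hm hV fun n => ?_
  have hmin_nonneg : ∀ z, 0 ≤ min (V z) (n : ℝ) := fun z => le_min (hV z) n.cast_nonneg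
  have hmin_m : Measurable fun z => min (V z) (n : ℝ) := hm.min measurable_const
  have hmin_norm : ∀ z, ‖min (V z) (n : ℝ)‖ = min (V z) n := fun z =>
    Real.norm_of_nonneg (hmin_nonneg z)
  have hmin_μ : Integrable (fun z => min (V z) (n : ℝ)) μ :=
    hμ.mono' hmin_m.aestronglyMeasurable (ae_of_all _ fun z => by
      rw [hmin_norm]
      exact min_le_left _ _)
  have hmin_ν : Integrable (fun z => min (V z) (n : ℝ)) ν :=
    Integrable.of_bound hmin_m.aestronglyMeasurable n (ae_of_all _ fun z => by
      rw [hmin_norm]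
      exact min_le_right _ _)
  rw [wVariation_comm] at hvar
  have hsub := integral_sub_integral_le_of_wVariation_le hr hvar hmin_m
    (fun z => (hmin_norm z).trans_le (min_le_left _ _)) hmin_ν hmin_μ
  have hmin_le : ∫ z, min (V z) (n : ℝ) ∂μ ≤ ∫ z, V z ∂μ :=
    integral_mono hmin_μ hμ fun z => min_le_left _ _
  linarith

lemma wVariation_le_of_kernelWVariation_le {Q Q' : Kernel Z Z} {D : ℝ} {z : Z} (hV : 0 < V z)
    (hD : 0 ≤ D) (h : kernelWVariation V Q Q' ≤ ENNReal.ofReal D) :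
    wVariation V (Q z) (Q' z) ≤ ENNReal.ofReal (D * V z) := by
  rw [ENNReal.ofReal_mul hD, ← ENNReal.div_le_iff (by simpa using hV) ENNReal.ofReal_ne_top]
  exact (le_iSup (fun z => wVariation V (Q z) (Q' z) / ENNReal.ofReal (V z)) z).trans h

end WeightedVariation

section PoissonEquation

variable {Z : Type*} [MeasurableSpace Z]

/-- The Markov kernel `Q` is geometrically ergodic in `V`-variation: its iterates converge to the
invariant law `μ` at rate `C * ρ ^ n * V z`. The case `n = 0`, where `Q ^ 0` is the identity kernel,
is included, so that `V` is integrable under `μ` and under all the iterates. -/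
structure IsGeomErgodic (V : Z → ℝ) (Q : Kernel Z Z) (μ : Measure Z) (C ρ : ℝ) : Prop where
  measurable_weight : Measurable V
  one_le_weight : ∀ z, 1 ≤ V z
  isMarkovKernel : IsMarkovKernel Q
  isProbabilityMeasure : IsProbabilityMeasure μ
  invariant : Kernel.Invariant Q μ
  const_nonneg : 0 ≤ C
  rate_nonneg : 0 ≤ ρ
  rate_lt_one : ρ < 1
  wVariation_pow_le : ∀ (n : ℕ) (z : Z),
    wVariation V ((Q ^ n) z) μ ≤ ENNReal.ofReal (C * ρ ^ n * V z)

/-- The solution `u = ∑ n, (Qⁿ h - μ h)` of the Poisson equation `u - Q u = h - μ h`. -/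
def poisson (Q : Kernel Z Z) (μ : Measure Z) (h : Z → ℝ) (z : Z) : ℝ :=
  ∑' n : ℕ, (∫ y, h y ∂((Q ^ n) z) - ∫ y, h y ∂μ)

lemma isMarkovKernel_pow (Q : Kernel Z Z) [IsMarkovKernel Q] (n : ℕ) : IsMarkovKernel (Q ^ n) := by
  induction n with
  | zero => exact inferInstanceAs (IsMarkovKernel Kernel.id)
  | succ n ih =>
    rw [pow_succ]
    exact inferInstanceAs (IsMarkovKernel ((Q ^ n) ∘ₖ Q))

lemma integral_kernel_pow_zero {Q : Kernel Z Z} {z : Z} {h : Z → ℝ} (hm : Measurable h) :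
    ∫ y, h y ∂((Q ^ 0) z) = h z := by
  rw [pow_zero, show (1 : Kernel Z Z) = Kernel.id from rfl, Kernel.id_apply,
    integral_dirac' _ _ hm.stronglyMeasurable]

lemma integral_kernel_pow_succ {Q : Kernel Z Z} {n : ℕ} {z : Z} {h : Z → ℝ}
    (hh : Integrable h ((Q ^ (n + 1)) z)) :
    ∫ y, h y ∂((Q ^ (n + 1)) z) = ∫ y, ∫ y', h y' ∂(Q y) ∂((Q ^ n) z) := by
  have hcomp : Q ^ (n + 1) = Q ∘ₖ (Q ^ n) := pow_succ' Q n
  rw [hcomp] at hh ⊢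
  exact Kernel.integral_comp hh

lemma integral_kernel_pow_succ' {Q : Kernel Z Z} {n : ℕ} {z : Z} {h : Z → ℝ}
    (hh : Integrable h ((Q ^ (n + 1)) z)) :
    ∫ y, h y ∂((Q ^ (n + 1)) z) = ∫ y, ∫ y', h y' ∂((Q ^ n) y) ∂(Q z) := by
  have hcomp : Q ^ (n + 1) = (Q ^ n) ∘ₖ Q := pow_succ Q n
  rw [hcomp] at hh ⊢
  exact Kernel.integral_comp hh

lemma integrable_integral_of_invariant {Q : Kernel Z Z} {μ : Measure Z}
    (hQ : Kernel.Invariant Q μ) {h : Z → ℝ} (hh : Integrable h μ) :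
    Integrable (fun z => ∫ y, h y ∂(Q z)) μ := by
  rw [← hQ.def, Measure.comp_eq_comp_const_apply] at hh
  simpa using hh.integral_comp

lemma integral_integral_of_invariant {Q : Kernel Z Z} {μ : Measure Z}
    (hQ : Kernel.Invariant Q μ) {h : Z → ℝ} (hh : Integrable h μ) :
    ∫ z, ∫ y, h y ∂(Q z) ∂μ = ∫ z, h z ∂μ := by
  have hcomp : (Q ∘ₖ Kernel.const Unit μ) () = μ := by
    rw [← Measure.comp_eq_comp_const_apply, hQ.def]
  rw [← hcomp] at hh
  have hint := Kernel.integral_comp hh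
  rw [hcomp] at hint
  simpa using hint.symm

lemma measurable_poisson {Q : Kernel Z Z} {μ : Measure Z} {h : Z → ℝ} (hm : Measurable h) :
    Measurable (poisson Q μ h) :=
  Measurable.tsum fun _ => hm.stronglyMeasurable.integral_kernel.measurable.sub_const _

namespace IsGeomErgodic

variable {V : Z → ℝ} {Q : Kernel Z Z} {μ : Measure Z} {C ρ : ℝ}

lemma weight_pos (H : IsGeomErgodic V Q μ C ρ) (z : Z) : 0 < V z :=
  one_pos.trans_le (H.one_le_weight z)

lemma sum_const_nonneg (H : IsGeomErgodic V Q μ C ρ) : 0 ≤ C * (1 - ρ)⁻¹ :=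
  mul_nonneg H.const_nonneg (inv_nonneg.2 (sub_nonneg.2 H.rate_lt_one.le))

lemma rate_bound_nonneg (H : IsGeomErgodic V Q μ C ρ) (n : ℕ) (z : Z) : 0 ≤ C * ρ ^ n * V z :=
  mul_nonneg (mul_nonneg H.const_nonneg (pow_nonneg H.rate_nonneg n)) (H.weight_pos z).le

lemma hasSum_mul_rate_pow (H : IsGeomErgodic V Q μ C ρ) (c : ℝ) :
    HasSum (fun n : ℕ => c * ρ ^ n) (c * (1 - ρ)⁻¹) :=
  (hasSum_geometric_of_lt_one H.rate_nonneg H.rate_lt_one).mul_left c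

lemma integrable_and_integral_le (H : IsGeomErgodic V Q μ C ρ) (z : Z) :
    Integrable V μ ∧ ∫ y, V y ∂μ ≤ (1 + C) * V z := by
  have := H.isProbabilityMeasure
  have hdirac : Integrable V ((Q ^ 0) z) := by
    rw [pow_zero, show (1 : Kernel Z Z) = Kernel.id from rfl, Kernel.id_apply]
    exact integrable_dirac' H.measurable_weight.stronglyMeasurable enorm_lt_top
  have hμ := integrable_of_wVariation_le H.measurable_weight (fun y => (H.weight_pos y).le)
    (H.rate_bound_nonneg 0 z) (H.wVariation_pow_le 0 z) hdirac
  rw [integral_kernel_pow_zero H.measurable_weight, pow_zero, mul_one] at hμ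
  exact ⟨hμ.1, hμ.2.trans_eq (by ring)⟩

lemma integrable_weight (H : IsGeomErgodic V Q μ C ρ) : Integrable V μ := by
  have := H.isProbabilityMeasure
  obtain ⟨z⟩ : Nonempty Z := nonempty_of_isProbabilityMeasure μ
  exact (H.integrable_and_integral_le z).1

lemma integrable_weight_pow (H : IsGeomErgodic V Q μ C ρ) (n : ℕ) (z : Z) :
    Integrable V ((Q ^ n) z) := by
  have := H.isMarkovKernel
  have := isMarkovKernel_pow Q n
  exact (integrable_of_wVariation_le H.measurable_weight (fun y => (H.weight_pos y).le)
    (H.rate_bound_nonneg n z) ((wVariation_comm V _ _).trans_le (H.wVariation_pow_le n z))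
    H.integrable_weight).1

lemma integrable_weight_kernel (H : IsGeomErgodic V Q μ C ρ) (z : Z) : Integrable V (Q z) := by
  simpa using H.integrable_weight_pow 1 z

variable {h : Z → ℝ} {c : ℝ}

lemma abs_integral_pow_sub_le (H : IsGeomErgodic V Q μ C ρ) (hh : IsDominated V c h) (n : ℕ)
    (z : Z) : |∫ y, h y ∂((Q ^ n) z) - ∫ y, h y ∂μ| ≤ c * C * V z * ρ ^ n :=
  (hh.abs_integral_sub_integral_le (H.rate_bound_nonneg n z) (H.wVariation_pow_le n z)
    (hh.integrable (H.integrable_weight_pow n z)) (hh.integrable H.integrable_weight)).trans_eq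
    (by ring)

lemma hasSum_poisson (H : IsGeomErgodic V Q μ C ρ) (hh : IsDominated V c h) (z : Z) :
    HasSum (fun n : ℕ => ∫ y, h y ∂((Q ^ n) z) - ∫ y, h y ∂μ) (poisson Q μ h z) :=
  (Summable.of_norm_bounded (H.hasSum_mul_rate_pow _).summable
    (H.abs_integral_pow_sub_le hh · z)).hasSum

lemma isDominated_poisson (H : IsGeomErgodic V Q μ C ρ) (hh : IsDominated V c h) :
    IsDominated V (c * (C * (1 - ρ)⁻¹)) (poisson Q μ h) where
  nonneg := mul_nonneg hh.nonneg H.sum_const_nonneg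
  measurable := measurable_poisson hh.measurable
  abs_le z := by
    have htsum := tsum_of_norm_bounded
      (f := fun n : ℕ => ∫ y, h y ∂((Q ^ n) z) - ∫ y, h y ∂μ) (H.hasSum_mul_rate_pow _)
      (H.abs_integral_pow_sub_le hh · z)
    exact htsum.trans_eq (by ring)

lemma isDominated_sub_integral (H : IsGeomErgodic V Q μ C ρ) (hh : IsDominated V c h) :
    IsDominated V (c + c * ∫ y, V y ∂μ) fun z => h z - ∫ y, h y ∂μ :=
  hh.sub (.const H.one_le_weight (hh.abs_integral_le H.integrable_weight))

lemma poisson_sub (H : IsGeomErgodic V Q μ C ρ) (hh : IsDominated V c h) {h' : Z → ℝ} {c' : ℝ}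
    (hh' : IsDominated V c' h') (z : Z) :
    poisson Q μ (fun y => h y - h' y) z = poisson Q μ h z - poisson Q μ h' z := by
  have hsub := (H.hasSum_poisson hh z).sub (H.hasSum_poisson hh' z)
  rw [← hsub.tsum_eq]
  refine tsum_congr fun n => ?_
  rw [integral_sub (hh.integrable (H.integrable_weight_pow n z))
      (hh'.integrable (H.integrable_weight_pow n z)),
    integral_sub (hh.integrable H.integrable_weight) (hh'.integrable H.integrable_weight)]
  ring

lemma poisson_const (H : IsGeomErgodic V Q μ C ρ) (a : ℝ) (z : Z) :
    poisson Q μ (fun _ => a) z = 0 := by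
  have := H.isMarkovKernel
  have := H.isProbabilityMeasure
  have := isMarkovKernel_pow Q
  simp [poisson]

lemma integral_integral_pow_sub (H : IsGeomErgodic V Q μ C ρ) (hh : IsDominated V c h) (n : ℕ)
    (z : Z) : ∫ y, (∫ y', h y' ∂((Q ^ n) y) - ∫ y', h y' ∂μ) ∂(Q z) =
      ∫ y, h y ∂((Q ^ (n + 1)) z) - ∫ y, h y ∂μ := by
  have := H.isMarkovKernel
  have hint := hh.integrable (H.integrable_weight_pow (n + 1) z)
  have hcomp : Q ^ (n + 1) = (Q ^ n) ∘ₖ Q := pow_succ Q n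
  rw [integral_kernel_pow_succ' hint, integral_sub _ (integrable_const _)]
  · simp
  · rw [hcomp] at hint
    exact hint.integral_comp

lemma hasSum_integral_poisson (H : IsGeomErgodic V Q μ C ρ) (hh : IsDominated V c h) (z : Z) :
    HasSum (fun n : ℕ => ∫ y, h y ∂((Q ^ (n + 1)) z) - ∫ y, h y ∂μ)
      (∫ y, poisson Q μ h y ∂(Q z)) := by
  have hterm : ∀ n, IsDominated V (c * C * ρ ^ n)
      fun y => ∫ y', h y' ∂((Q ^ n) y) - ∫ y', h y' ∂μ := fun n =>
    { nonneg := mul_nonneg (mul_nonneg hh.nonneg H.const_nonneg) (pow_nonneg H.rate_nonneg n)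
      measurable := hh.measurable.stronglyMeasurable.integral_kernel.measurable.sub_const _
      abs_le := fun y => (H.abs_integral_pow_sub_le hh n y).trans_eq (by ring) }
  have hV := H.integrable_weight_kernel z
  have hnorm : ∀ n, ∫ y, ‖∫ y', h y' ∂((Q ^ n) y) - ∫ y', h y' ∂μ‖ ∂(Q z) ≤
      c * C * (∫ y, V y ∂(Q z)) * ρ ^ n := fun n =>
    calc _ ≤ ∫ y, c * C * ρ ^ n * V y ∂(Q z) :=
          integral_mono ((hterm n).integrable hV).norm (hV.const_mul _) (hterm n).abs_le
      _ = _ := by rw [integral_const_mul]; ring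
  simp_rw [← H.integral_integral_pow_sub hh]
  exact hasSum_integral_of_summable_integral_norm (fun n => (hterm n).integrable hV)
    (Summable.of_nonneg_of_le (fun n => integral_nonneg fun _ => norm_nonneg _) hnorm
      (H.hasSum_mul_rate_pow _).summable)

theorem poisson_sub_integral_poisson (H : IsGeomErgodic V Q μ C ρ) (hh : IsDominated V c h)
    (z : Z) : poisson Q μ h z - ∫ y, poisson Q μ h y ∂(Q z) = h z - ∫ y, h y ∂μ := by
  have hsplit := (H.hasSum_poisson hh z).summable.tsum_eq_zero_add
  rw [(H.hasSum_integral_poisson hh z).tsum_eq, integral_kernel_pow_zero hh.measurable] at hsplit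
  rw [poisson, hsplit]
  ring

lemma poisson_defect (H : IsGeomErgodic V Q μ C ρ) {w : Z → ℝ} {q : ℝ}
    (hw : IsDominated V c w) (hq : IsDominated V q fun z => w z - ∫ y, w y ∂(Q z)) (z : Z) :
    poisson Q μ (fun z => w z - ∫ y, w y ∂(Q z)) z = w z - ∫ y, w y ∂μ := by
  have hw_int := hw.integrable H.integrable_weight
  have hmean : ∫ y, (w y - ∫ y', w y' ∂(Q y)) ∂μ = 0 := by
    rw [integral_sub hw_int (integrable_integral_of_invariant H.invariant hw_int),
      integral_integral_of_invariant H.invariant hw_int, sub_self]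
  have htelescope : ∀ n, ∫ y, (w y - ∫ y', w y' ∂(Q y)) ∂((Q ^ n) z) -
      ∫ y, (w y - ∫ y', w y' ∂(Q y)) ∂μ =
      ∫ y, w y ∂((Q ^ n) z) - ∫ y, w y ∂((Q ^ (n + 1)) z) := fun n => by
    have hint := hw.integrable (H.integrable_weight_pow (n + 1) z)
    have hcomp : Q ^ (n + 1) = Q ∘ₖ (Q ^ n) := pow_succ' Q n
    rw [hmean, sub_zero, integral_kernel_pow_succ hint,
      integral_sub (hw.integrable (H.integrable_weight_pow n z))]
    rw [hcomp] at hint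
    exact hint.integral_comp
  have hpartial := (H.hasSum_poisson hq z).tendsto_sum_nat
  simp_rw [htelescope, Finset.sum_range_sub'] at hpartial
  rw [integral_kernel_pow_zero hw.measurable] at hpartial
  have hlimit : Tendsto (fun n => ∫ y, w y ∂((Q ^ n) z)) atTop (𝓝 (∫ y, w y ∂μ)) := by
    simpa using (H.hasSum_poisson hw z).summable.tendsto_atTop_zero.add_const (∫ y, w y ∂μ)
  exact tendsto_nhds_unique hpartial (hlimit.const_sub (w z))

lemma isDominated_sub_integral_of_defect (H : IsGeomErgodic V Q μ C ρ) {w : Z → ℝ} {q : ℝ}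
    (hw : IsDominated V c w) (hq : IsDominated V q fun z => w z - ∫ y, w y ∂(Q z)) :
    IsDominated V (q * (C * (1 - ρ)⁻¹)) fun z => w z - ∫ y, w y ∂μ := by
  rw [← funext (H.poisson_defect hw hq)]
  exact H.isDominated_poisson hq

lemma integral_poisson (H : IsGeomErgodic V Q μ C ρ) (hh : IsDominated V c h) :
    ∫ y, poisson Q μ h y ∂μ = 0 := by
  have := H.isProbabilityMeasure
  obtain ⟨z⟩ : Nonempty Z := nonempty_of_isProbabilityMeasure μ
  have hdefect := funext (H.poisson_sub_integral_poisson hh)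
  have hcentered := H.poisson_defect (H.isDominated_poisson hh)
    (hdefect ▸ H.isDominated_sub_integral hh) z
  rw [hdefect, H.poisson_sub hh (.const H.one_le_weight le_rfl), H.poisson_const] at hcentered
  linarith

end IsGeomErgodic

end PoissonEquation

section Perturbation

variable {Z : Type*} [MeasurableSpace Z]

namespace IsGeomErgodic

variable {V : Z → ℝ} {Q Q' : Kernel Z Z} {μ μ' : Measure Z} {C ρ D c : ℝ} {h : Z → ℝ}

lemma isDominated_integral_kernel_sub (H : IsGeomErgodic V Q μ C ρ)
    (H' : IsGeomErgodic V Q' μ' C ρ) (hD : 0 ≤ D)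
    (hQ : kernelWVariation V Q Q' ≤ ENNReal.ofReal D) (hh : IsDominated V c h) :
    IsDominated V (c * D) fun z => ∫ y, h y ∂(Q z) - ∫ y, h y ∂(Q' z) where
  nonneg := mul_nonneg hh.nonneg hD
  measurable := hh.measurable.stronglyMeasurable.integral_kernel.measurable.sub
    hh.measurable.stronglyMeasurable.integral_kernel.measurable
  abs_le z := by
    have hV := H.weight_pos z
    rw [mul_assoc]
    exact hh.abs_integral_sub_integral_le (mul_nonneg hD hV.le)
      (wVariation_le_of_kernelWVariation_le hV hD hQ)
      (hh.integrable (H.integrable_weight_kernel z)) (hh.integrable (H'.integrable_weight_kernel z))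

lemma integral_sub_integral_eq (H : IsGeomErgodic V Q μ C ρ) (H' : IsGeomErgodic V Q' μ' C ρ)
    (hh : IsDominated V c h) : ∫ y, h y ∂μ - ∫ y, h y ∂μ' =
      ∫ z, (∫ y, poisson Q' μ' h y ∂(Q z) - ∫ y, poisson Q' μ' h y ∂(Q' z)) ∂μ := by
  have := H.isProbabilityMeasure
  have hv := (H'.isDominated_poisson hh).integrable H.integrable_weight
  have hhμ := hh.integrable H.integrable_weight
  have hcentered : Integrable (fun z => h z - ∫ y, h y ∂μ') μ := hhμ.sub (integrable_const _)
  have hQ' : ∀ z, ∫ y, poisson Q' μ' h y ∂(Q' z) =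
      poisson Q' μ' h z - (h z - ∫ y, h y ∂μ') := fun z => by
    linarith [H'.poisson_sub_integral_poisson hh z]
  have hvQ' : Integrable (fun z => poisson Q' μ' h z - (h z - ∫ y, h y ∂μ')) μ := hv.sub hcentered
  simp_rw [hQ']
  rw [integral_sub (integrable_integral_of_invariant H.invariant hv) hvQ',
    integral_integral_of_invariant H.invariant hv, integral_sub hv hcentered,
    integral_sub hhμ (integrable_const _)]
  simp

lemma abs_integral_sub_integral_le (H : IsGeomErgodic V Q μ C ρ)
    (H' : IsGeomErgodic V Q' μ' C ρ) (hD : 0 ≤ D)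
    (hQ : kernelWVariation V Q Q' ≤ ENNReal.ofReal D) (hh : IsDominated V c h) :
    |∫ y, h y ∂μ - ∫ y, h y ∂μ'| ≤ c * (C * (1 - ρ)⁻¹) * D * ∫ y, V y ∂μ := by
  rw [H.integral_sub_integral_eq H' hh]
  exact (H.isDominated_integral_kernel_sub H' hD hQ (H'.isDominated_poisson hh)).abs_integral_le
    H.integrable_weight

lemma isDominated_poisson_sub_poisson (H : IsGeomErgodic V Q μ C ρ)
    (H' : IsGeomErgodic V Q' μ' C ρ) (hD : 0 ≤ D)
    (hQ : kernelWVariation V Q Q' ≤ ENNReal.ofReal D) (hh : IsDominated V c h) :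
    IsDominated V (c * (C * (1 - ρ)⁻¹) ^ 2 * (2 * (∫ y, V y ∂μ) + 1) * D)
      fun z => poisson Q μ h z - poisson Q' μ' h z := by
  set S := C * (1 - ρ)⁻¹
  set u := poisson Q μ h with hu
  set v := poisson Q' μ' h with hv
  have hu_dom : IsDominated V (c * S) u := H.isDominated_poisson hh
  have hv_dom : IsDominated V (c * S) v := H'.isDominated_poisson hh
  have hdefect : (fun z => (u z - v z) - ∫ y, (u y - v y) ∂(Q z)) =
      fun z => (∫ y, v y ∂(Q z) - ∫ y, v y ∂(Q' z)) - (∫ y, h y ∂μ - ∫ y, h y ∂μ') := by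
    ext z
    rw [integral_sub (hu_dom.integrable (H.integrable_weight_kernel z))
      (hv_dom.integrable (H.integrable_weight_kernel z))]
    linarith [H.poisson_sub_integral_poisson hh z, H'.poisson_sub_integral_poisson hh z]
  have hcentered := H.isDominated_sub_integral_of_defect (hu_dom.sub hv_dom)
    (hdefect ▸ (H.isDominated_integral_kernel_sub H' hD hQ hv_dom).sub
      (.const H.one_le_weight (H.abs_integral_sub_integral_le H' hD hQ hh)))
  have hmean : |∫ y, (u y - v y) ∂μ| ≤ c * S * S * D * ∫ y, V y ∂μ := by
    rw [integral_sub (hu_dom.integrable H.integrable_weight)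
      (hv_dom.integrable H.integrable_weight), hu, H.integral_poisson hh, zero_sub, abs_neg]
    simpa [hv, H'.integral_poisson hh] using H.abs_integral_sub_integral_le H' hD hQ hv_dom
  have hsum := hcentered.add (.const H.one_le_weight hmean)
  simp only [sub_add_cancel] at hsum
  convert hsum using 1
  ring

end IsGeomErgodic

end Perturbation

section LipschitzFamily

variable {Z T : Type*} [MeasurableSpace Z] [MetricSpace T]

/-- The functions `h t` are bounded by `c` and `L`-Lipschitz in `t`, both in `V`-norm. -/
structure IsLipschitzFamily (V : Z → ℝ) (c L : ℝ) (h : T → Z → ℝ) : Prop where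
  isDominated : ∀ t, IsDominated V c (h t)
  isDominated_sub : ∀ t t', IsDominated V (L * dist t t') fun z => h t z - h t' z

/-- A family of kernels that are geometrically ergodic in `V`-variation with common constants, and
`D`-Lipschitz in the parameter. -/
structure IsErgodicFamily (V : Z → ℝ) (Q : T → Kernel Z Z) (μ : T → Measure Z) (C ρ B D : ℝ) :
    Prop where
  isGeomErgodic : ∀ t, IsGeomErgodic V (Q t) (μ t) C ρ
  integral_weight_le : ∀ t, ∫ z, V z ∂(μ t) ≤ B
  lipschitz_nonneg : 0 ≤ D
  kernelWVariation_le : ∀ t t', kernelWVariation V (Q t) (Q t') ≤ ENNReal.ofReal (D * dist t t')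

lemma IsDominated.mono {V h : Z → ℝ} {c c' : ℝ} (hh : IsDominated V c h) (hV : ∀ z, 0 ≤ V z)
    (hc : c ≤ c') : IsDominated V c' h where
  nonneg := hh.nonneg.trans hc
  measurable := hh.measurable
  abs_le z := (hh.abs_le z).trans (mul_le_mul_of_nonneg_right hc (hV z))

variable {V : Z → ℝ} {Q : T → Kernel Z Z} {μ : T → Measure Z} {C ρ B D c L : ℝ} {h : T → Z → ℝ}

namespace IsLipschitzFamily

lemma sub (hh : IsLipschitzFamily V c L h) {h' : T → Z → ℝ} {c' L' : ℝ}
    (hh' : IsLipschitzFamily V c' L' h') :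
    IsLipschitzFamily V (c + c') (L + L') fun t z => h t z - h' t z where
  isDominated t := (hh.isDominated t).sub (hh'.isDominated t)
  isDominated_sub t t' := by
    convert (hh.isDominated_sub t t').sub (hh'.isDominated_sub t t') using 1
    · ring
    · ext z
      ring

lemma measurable_uncurry [SecondCountableTopology T] [MeasurableSpace T] [OpensMeasurableSpace T]
    (hh : IsLipschitzFamily V c L h) : Measurable (Function.uncurry h) := by
  refine measurable_uncurry_of_continuous_of_measurable (fun z => ?_)
    fun t => (hh.isDominated t).measurable
  refine (LipschitzWith.of_dist_le' (K := L * V z) fun t t' => ?_).continuous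
  rw [Real.dist_eq, mul_right_comm]
  exact (hh.isDominated_sub t t').abs_le z

end IsLipschitzFamily

namespace IsErgodicFamily

lemma isLipschitzFamily_integral (H : IsErgodicFamily V Q μ C ρ B D)
    (hh : IsLipschitzFamily V c L h) :
    IsLipschitzFamily V (c * B) ((L + c * (C * (1 - ρ)⁻¹) * D) * B)
      fun t _ => ∫ y, h t y ∂(μ t) where
  isDominated t := .const (H.isGeomErgodic t).one_le_weight <|
    ((hh.isDominated t).abs_integral_le (H.isGeomErgodic t).integrable_weight).trans
      (mul_le_mul_of_nonneg_left (H.integral_weight_le t) (hh.isDominated t).nonneg)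
  isDominated_sub t t' := by
    have Ht := H.isGeomErgodic t
    have hD := mul_nonneg H.lipschitz_nonneg (dist_nonneg (x := t) (y := t'))
    refine .const Ht.one_le_weight ?_
    have hfunction := (hh.isDominated_sub t t').abs_integral_le Ht.integrable_weight
    rw [integral_sub ((hh.isDominated t).integrable Ht.integrable_weight)
      ((hh.isDominated t').integrable Ht.integrable_weight)] at hfunction
    have hmeasure := Ht.abs_integral_sub_integral_le (H.isGeomErgodic t') hD
      (H.kernelWVariation_le t t') (hh.isDominated t')
    calc |∫ y, h t y ∂(μ t) - ∫ y, h t' y ∂(μ t')|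
        ≤ L * dist t t' * ∫ y, V y ∂(μ t) +
          c * (C * (1 - ρ)⁻¹) * (D * dist t t') * ∫ y, V y ∂(μ t) :=
          (abs_sub_le _ (∫ y, h t' y ∂(μ t)) _).trans (add_le_add hfunction hmeasure)
      _ = (L * dist t t' + c * (C * (1 - ρ)⁻¹) * (D * dist t t')) * ∫ y, V y ∂(μ t) := by ring
      _ ≤ (L * dist t t' + c * (C * (1 - ρ)⁻¹) * (D * dist t t')) * B :=
          mul_le_mul_of_nonneg_left (H.integral_weight_le t) <|
            add_nonneg (hh.isDominated_sub t t').nonneg <|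
              mul_nonneg (mul_nonneg (hh.isDominated t).nonneg Ht.sum_const_nonneg) hD
      _ = (L + c * (C * (1 - ρ)⁻¹) * D) * B * dist t t' := by ring

lemma isLipschitzFamily_poisson (H : IsErgodicFamily V Q μ C ρ B D)
    (hh : IsLipschitzFamily V c L h) :
    IsLipschitzFamily V (c * (C * (1 - ρ)⁻¹))
      (L * (C * (1 - ρ)⁻¹) + c * (C * (1 - ρ)⁻¹) ^ 2 * (2 * B + 1) * D)
      fun t => poisson (Q t) (μ t) (h t) where
  isDominated t := (H.isGeomErgodic t).isDominated_poisson (hh.isDominated t)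
  isDominated_sub t t' := by
    have Ht := H.isGeomErgodic t
    have hD := mul_nonneg H.lipschitz_nonneg (dist_nonneg (x := t) (y := t'))
    have hfunction := Ht.isDominated_poisson (hh.isDominated_sub t t')
    have hkernel := Ht.isDominated_poisson_sub_poisson (H.isGeomErgodic t') hD
      (H.kernelWVariation_le t t') (hh.isDominated t')
    have hconst : c * (C * (1 - ρ)⁻¹) ^ 2 * (2 * (∫ y, V y ∂(μ t)) + 1) * (D * dist t t') ≤
        c * (C * (1 - ρ)⁻¹) ^ 2 * (2 * B + 1) * (D * dist t t') :=
      mul_le_mul_of_nonneg_right (mul_le_mul_of_nonneg_left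
        (by linarith [H.integral_weight_le t])
        (mul_nonneg (hh.isDominated t).nonneg (sq_nonneg _))) hD
    convert hfunction.add (hkernel.mono (fun z => (Ht.weight_pos z).le) hconst) using 1
    · ring
    · ext z
      rw [Ht.poisson_sub (hh.isDominated t) (hh.isDominated t')]
      ring

lemma isLipschitzFamily_integral_poisson (H : IsErgodicFamily V Q μ C ρ B D)
    (hh : IsLipschitzFamily V c L h) :
    ∃ c' L' : ℝ, IsLipschitzFamily V c' L' fun t z =>
      ∫ y, poisson (Q t) (μ t) (h t) y ∂(Q t z) := by
  have hpoisson : (fun t z => ∫ y, poisson (Q t) (μ t) (h t) y ∂(Q t z)) = fun t z =>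
      poisson (Q t) (μ t) (h t) z - (h t z - ∫ y, h t y ∂(μ t)) := by
    ext t z
    linarith [(H.isGeomErgodic t).poisson_sub_integral_poisson (hh.isDominated t) z]
  rw [hpoisson]
  exact ⟨_, _, (H.isLipschitzFamily_poisson hh).sub (hh.sub (H.isLipschitzFamily_integral hh))⟩

lemma exists_kernel_sectR_eq [SecondCountableTopology T] [MeasurableSpace T]
    [OpensMeasurableSpace T] (H : IsErgodicFamily V Q μ C ρ B D) :
    ∃ κ : Kernel (T × Z) Z, ∀ t, κ.sectR t = Q t := by
  have := fun t => (H.isGeomErgodic t).isMarkovKernel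
  have hmeas : Measurable fun q : T × Z => Q q.1 q.2 := by
    refine Measure.measurable_of_measurable_coe _ fun A hA => ?_
    have hindicator (t : T) : IsDominated V 1 (A.indicator fun _ => (1 : ℝ)) :=
      { nonneg := zero_le_one
        measurable := measurable_const.indicator hA
        abs_le := fun z => by
          rw [one_mul]
          refine le_trans ?_ ((H.isGeomErgodic t).one_le_weight z)
          by_cases hz : z ∈ A <;> simp [hz] }
    have hreal : IsLipschitzFamily V 1 D fun t z => (Q t z).real A :=
      { isDominated := fun t =>
          { nonneg := zero_le_one
            measurable := (Kernel.measurable_coe (Q t) hA).ennreal_toReal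
            abs_le := fun z => by
              rw [one_mul, abs_of_nonneg measureReal_nonneg]
              exact measureReal_le_one.trans ((H.isGeomErgodic t).one_le_weight z) }
        isDominated_sub := fun t t' => by
          simpa [integral_indicator_const _ hA] using
            (H.isGeomErgodic t).isDominated_integral_kernel_sub (H.isGeomErgodic t')
              (mul_nonneg H.lipschitz_nonneg dist_nonneg) (H.kernelWVariation_le t t')
              (hindicator t) }
    convert hreal.measurable_uncurry.ennreal_ofReal using 2 with q
    simp [Function.uncurry]
  exact ⟨⟨_, hmeas⟩, fun t => rfl⟩

end IsErgodicFamily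

end LipschitzFamily

section ConditionalLaw

variable {Ω S Z : Type*} {m m0 : MeasurableSpace Ω} [MeasurableSpace S] [MeasurableSpace Z]

/-- The conditional law of `Y` given `m` is `κ (p ·)`, where the parameter `p` is
`m`-measurable. -/
structure HasCondLaw (P : Measure[m0] Ω) (m : MeasurableSpace Ω) (p : Ω → S) (Y : Ω → Z)
    (κ : Kernel S Z) : Prop where
  le : m ≤ m0
  measurable_param : Measurable[m] p
  measurable : Measurable[m0] Y
  condProb_ae_eq : ∀ A, MeasurableSet A → P⟦Y ⁻¹' A|m⟧ =ᵐ[P] fun ω => (κ (p ω)).real A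

namespace HasCondLaw

variable {P : Measure[m0] Ω} [IsProbabilityMeasure P] {p : Ω → S} {Y : Ω → Z} {κ : Kernel S Z}
  [IsMarkovKernel κ]

lemma measure_preimage_inter (H : HasCondLaw P m p Y κ) {t : Set Ω} (ht : MeasurableSet[m] t)
    {B : Set Z} (hB : MeasurableSet B) : P (t ∩ Y ⁻¹' B) = ∫⁻ ω in t, κ (p ω) B ∂P := by
  have hp := H.measurable_param.mono H.le le_rfl
  have hreal : Integrable (fun ω => (κ (p ω)).real B) (P.restrict t) :=
    .of_bound ((Kernel.measurable_coe κ hB).comp hp).ennreal_toReal.aestronglyMeasurable 1 <|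
      ae_of_all _ fun ω => by
        rw [Real.norm_of_nonneg measureReal_nonneg]
        exact measureReal_le_one
  have hset : P.real (t ∩ Y ⁻¹' B) = ∫ ω in t, (κ (p ω)).real B ∂P := by
    rw [← setIntegral_congr_ae (H.le _ ht) ((H.condProb_ae_eq B hB).mono fun ω h _ => h),
      setIntegral_condExp H.le ((integrable_const 1).indicator (H.measurable hB)) ht,
      setIntegral_indicator (H.measurable hB)]
    simp
  rw [← ofReal_measureReal, hset,
    ofReal_integral_eq_lintegral_ofReal hreal (ae_of_all _ fun ω => measureReal_nonneg)]
  simp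

lemma map_restrict_eq_compProd (H : HasCondLaw P m p Y κ) {s : Set Ω} (hs : MeasurableSet[m] s) :
    (P.restrict s).map (fun ω => (p ω, Y ω)) = ((P.restrict s).map p) ⊗ₘ κ := by
  have hp := H.measurable_param.mono H.le le_rfl
  have hprod := hp.prodMk H.measurable
  have : IsFiniteMeasure ((P.restrict s).map fun ω => (p ω, Y ω)) :=
    Measure.isFiniteMeasure_map _ _
  refine Measure.ext_prod fun {A B} hA hB => ?_
  rw [Measure.compProd_apply_prod hA hB, setLIntegral_map hA (Kernel.measurable_coe κ hB) hp,
    Measure.restrict_restrict (hp hA),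
    ← H.measure_preimage_inter ((H.measurable_param hA).inter hs) hB,
    Measure.map_apply hprod (hA.prod hB), Measure.restrict_apply (hprod (hA.prod hB)),
    mk_preimage_prod, inter_right_comm]

lemma lintegral_eq (H : HasCondLaw P m p Y κ) {F : Z → ℝ≥0∞} (hF : Measurable F) :
    ∫⁻ ω, F (Y ω) ∂P = ∫⁻ ω, ∫⁻ y, F y ∂(κ (p ω)) ∂P := by
  have hp := H.measurable_param.mono H.le le_rfl
  have hmap := H.map_restrict_eq_compProd MeasurableSet.univ
  have hF' : Measurable fun q : S × Z => F q.2 := hF.comp measurable_snd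
  rw [Measure.restrict_univ] at hmap
  rw [← lintegral_map (Measurable.lintegral_kernel hF) hp, ← Measure.lintegral_compProd hF', ← hmap,
    lintegral_map hF' (hp.prodMk H.measurable)]

lemma condExp_ae_eq (H : HasCondLaw P m p Y κ) {F : S × Z → ℝ} (hF : Measurable F)
    (hint : Integrable (fun ω => F (p ω, Y ω)) P) :
    P[fun ω => F (p ω, Y ω)|m] =ᵐ[P] fun ω => ∫ y, F (p ω, y) ∂(κ (p ω)) := by
  have hp := H.measurable_param.mono H.le le_rfl
  have hprod := hp.prodMk H.measurable
  have hintegral : Measurable fun a => ∫ y, F (a, y) ∂(κ a) :=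
    hF.stronglyMeasurable.integral_kernel_prod_right'.measurable
  have hcomp : ∀ s, MeasurableSet[m] s → Integrable F (((P.restrict s).map p) ⊗ₘ κ) :=
    fun s hs => by
      rw [← H.map_restrict_eq_compProd hs,
        integrable_map_measure hF.aestronglyMeasurable hprod.aemeasurable]
      exact hint.restrict
  refine (ae_eq_condExp_of_forall_setIntegral_eq H.le hint (fun s hs _ => ?_) (fun s hs _ => ?_)
    (hintegral.comp H.measurable_param).aestronglyMeasurable).symm
  · exact (integrable_map_measure hintegral.aestronglyMeasurable hp.aemeasurable).1
      (by simpa using (hcomp s hs).integral_compProd)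
  · simp only [Function.comp_apply]
    rw [← integral_map (f := fun a => ∫ y, F (a, y) ∂(κ a)) hp.aemeasurable
        hintegral.aestronglyMeasurable, ← Measure.integral_compProd (hcomp s hs),
      ← H.map_restrict_eq_compProd hs, integral_map hprod.aemeasurable hF.aestronglyMeasurable]

end HasCondLaw

end ConditionalLaw

section ControlledChain

variable {Ω Z T : Type*} {m0 : MeasurableSpace Ω} [MeasurableSpace Z] [MeasurableSpace T]

/-- A chain `z` controlled by the adapted parameters `x`: the conditional law of `z (n + 1)` given
the past `ℱ n` is `κ (x n, z n)`. -/
structure IsControlledChain (P : Measure Ω) (ℱ : Filtration ℕ m0) (κ : Kernel (T × Z) Z)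
    (x : ℕ → Ω → T) (z : ℕ → Ω → Z) : Prop where
  measurable_param : ∀ n, Measurable[ℱ n] (x n)
  measurable_state : ∀ n, Measurable[ℱ n] (z n)
  transition : ∀ n A, MeasurableSet A →
    P⟦z (n + 1) ⁻¹' A|ℱ n⟧ =ᵐ[P] fun ω => (κ (x n ω, z n ω)).real A

namespace IsControlledChain

variable {P : Measure Ω} {ℱ : Filtration ℕ m0} {κ : Kernel (T × Z) Z} {x : ℕ → Ω → T}
  {z : ℕ → Ω → Z}

lemma hasCondLaw (H : IsControlledChain P ℱ κ x z) (n : ℕ) :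
    HasCondLaw P (ℱ n) (fun ω => (x n ω, z n ω)) (z (n + 1)) κ where
  le := ℱ.le n
  measurable_param := (H.measurable_param n).prodMk (H.measurable_state n)
  measurable := (H.measurable_state (n + 1)).mono (ℱ.le _) le_rfl
  condProb_ae_eq := H.transition n

lemma lintegral_weight_le [IsProbabilityMeasure P] [IsMarkovKernel κ]
    (H : IsControlledChain P ℱ κ x z) {F : Z → ℝ≥0∞} (hF : Measurable F) {a b : ℝ≥0∞} (ha : a < 1)
    (hdrift : ∀ t z, ∫⁻ y, F y ∂(κ (t, z)) ≤ a * F z + b) (n : ℕ) :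
    ∫⁻ ω, F (z n ω) ∂P ≤ ∫⁻ ω, F (z 0 ω) ∂P + b / (1 - a) := by
  have hfixed : a * (b / (1 - a)) + b = b / (1 - a) := by
    have hsub : 1 - a ≠ 0 := (tsub_pos_of_lt ha).ne'
    calc a * (b / (1 - a)) + b = a * (b / (1 - a)) + (1 - a) * (b / (1 - a)) := by
          rw [ENNReal.mul_div_cancel hsub (by finiteness)]
      _ = b / (1 - a) := by rw [← add_mul, add_tsub_cancel_of_le ha.le, one_mul]
  induction n with
  | zero => exact le_self_add
  | succ n ih =>
    have hz := (H.measurable_state n).mono (ℱ.le n) le_rfl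
    calc ∫⁻ ω, F (z (n + 1) ω) ∂P
        = ∫⁻ ω, ∫⁻ y, F y ∂(κ (x n ω, z n ω)) ∂P := (H.hasCondLaw n).lintegral_eq hF
      _ ≤ ∫⁻ ω, (a * F (z n ω) + b) ∂P := lintegral_mono fun ω => hdrift _ _
      _ = a * ∫⁻ ω, F (z n ω) ∂P + b := by
          rw [lintegral_add_right _ measurable_const,
            lintegral_const_mul _ (f := fun ω => F (z n ω)) (hF.comp hz), lintegral_const,
            measure_univ, mul_one]
      _ ≤ a * (∫⁻ ω, F (z 0 ω) ∂P + b / (1 - a)) + b := by gcongr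
      _ ≤ ∫⁻ ω, F (z 0 ω) ∂P + b / (1 - a) := by
          rw [mul_add, add_assoc, hfixed]
          gcongr
          exact mul_le_of_le_one_left zero_le ha.le

end IsControlledChain

end ControlledChain

section MartingaleDifference

variable {Ω : Type*} {m0 : MeasurableSpace Ω}

/-- A sequence of square-integrable martingale differences, with the index shifted so that `D n` is
`ℱ (n + 1)`-measurable and centred given `ℱ n`. -/
structure IsL2MartingaleDifference (P : Measure Ω) (ℱ : Filtration ℕ m0) (D : ℕ → Ω → ℝ) :
    Prop where
  stronglyMeasurable : ∀ n, StronglyMeasurable[ℱ (n + 1)] (D n)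
  memLp : ∀ n, MemLp (D n) 2 P
  condExp_ae_eq_zero : ∀ n, P[D n|ℱ n] =ᵐ[P] 0

namespace IsL2MartingaleDifference

variable {P : Measure Ω} {ℱ : Filtration ℕ m0} {D : ℕ → Ω → ℝ}

lemma stronglyMeasurable_sum (H : IsL2MartingaleDifference P ℱ D) (n : ℕ) :
    StronglyMeasurable[ℱ n] (∑ k ∈ Finset.range n, D k) :=
  Finset.stronglyMeasurable_sum _ fun k hk =>
    (H.stronglyMeasurable k).mono (ℱ.mono (Finset.mem_range.1 hk))

lemma memLp_sum (H : IsL2MartingaleDifference P ℱ D) (n : ℕ) :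
    MemLp (∑ k ∈ Finset.range n, D k) 2 P :=
  memLp_finsetSum' _ fun k _ => H.memLp k

variable [IsFiniteMeasure P]

lemma martingale_sum (H : IsL2MartingaleDifference P ℱ D) :
    Martingale (fun n => ∑ k ∈ Finset.range n, D k) ℱ P := by
  have hint : ∀ n, Integrable (∑ k ∈ Finset.range n, D k) P := fun n =>
    (H.memLp_sum n).integrable one_le_two
  refine martingale_of_condExp_sub_eq_zero_nat H.stronglyMeasurable_sum hint fun n => ?_
  rw [Finset.sum_range_succ, add_sub_cancel_left]
  exact H.condExp_ae_eq_zero n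

lemma integral_sum_mul (H : IsL2MartingaleDifference P ℱ D) (n : ℕ) :
    ∫ ω, (∑ k ∈ Finset.range n, D k) ω * D n ω ∂P = 0 := by
  have hpull := condExp_mul_of_stronglyMeasurable_left (H.stronglyMeasurable_sum n)
    ((H.memLp_sum n).integrable_mul (H.memLp n)) ((H.memLp n).integrable one_le_two)
  calc ∫ ω, (∑ k ∈ Finset.range n, D k) ω * D n ω ∂P
      = ∫ ω, (P[(∑ k ∈ Finset.range n, D k) * D n|ℱ n]) ω ∂P := (integral_condExp (ℱ.le n)).symm
    _ = 0 := integral_eq_zero_of_ae <| by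
        filter_upwards [hpull, H.condExp_ae_eq_zero n] with ω hω hzero
        rw [hω, Pi.mul_apply, hzero, Pi.zero_apply, mul_zero]

lemma integral_sum_sq (H : IsL2MartingaleDifference P ℱ D) (n : ℕ) :
    ∫ ω, (∑ k ∈ Finset.range n, D k) ω ^ 2 ∂P = ∑ k ∈ Finset.range n, ∫ ω, D k ω ^ 2 ∂P := by
  induction n with
  | zero => simp
  | succ n ih =>
    have hS := (H.memLp_sum n).integrable_sq
    have hSD : Integrable (fun ω => 2 * ((∑ k ∈ Finset.range n, D k) ω * D n ω)) P :=
      ((H.memLp_sum n).integrable_mul (H.memLp n)).const_mul 2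
    have hsq : Integrable (fun ω => (∑ k ∈ Finset.range n, D k) ω ^ 2 +
        2 * ((∑ k ∈ Finset.range n, D k) ω * D n ω)) P := hS.add hSD
    calc ∫ ω, (∑ k ∈ Finset.range (n + 1), D k) ω ^ 2 ∂P
        = ∫ ω, ((∑ k ∈ Finset.range n, D k) ω ^ 2 +
            2 * ((∑ k ∈ Finset.range n, D k) ω * D n ω) + D n ω ^ 2) ∂P := by
          congr with ω
          rw [Finset.sum_range_succ, Pi.add_apply]
          ring
      _ = ∑ k ∈ Finset.range (n + 1), ∫ ω, D k ω ^ 2 ∂P := by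
          rw [integral_add hsq (H.memLp n).integrable_sq, integral_add hS hSD,
            integral_const_mul, H.integral_sum_mul, ih, Finset.sum_range_succ, mul_zero, add_zero]

lemma ae_summable (H : IsL2MartingaleDifference P ℱ D) (hD : Summable fun n => ∫ ω, D n ω ^ 2 ∂P) :
    ∀ᵐ ω ∂P, Summable (fun n => D n ω) (.conditional ℕ) := by
  have hbdd (n : ℕ) : eLpNorm (∑ k ∈ Finset.range n, D k) 1 P ≤
      (P.real univ + ∑' k, ∫ ω, D k ω ^ 2 ∂P).toNNReal := by
    have hS := (H.memLp_sum n).integrable_sq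
    rw [eLpNorm_one_eq_lintegral_enorm,
      ← ofReal_integral_norm_eq_lintegral_enorm ((H.memLp_sum n).integrable one_le_two)]
    refine ENNReal.ofReal_le_ofReal ?_
    calc ∫ ω, ‖(∑ k ∈ Finset.range n, D k) ω‖ ∂P
        ≤ ∫ ω, (1 + (∑ k ∈ Finset.range n, D k) ω ^ 2) ∂P :=
          integral_mono ((H.memLp_sum n).integrable one_le_two).norm
            ((integrable_const 1).add hS) fun ω => by
              simp only [Real.norm_eq_abs, ← sq_abs ((∑ k ∈ Finset.range n, D k) ω)]
              nlinarith [sq_nonneg (|(∑ k ∈ Finset.range n, D k) ω| - 1)]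
      _ = P.real univ + ∑ k ∈ Finset.range n, ∫ ω, D k ω ^ 2 ∂P := by
          rw [integral_add (integrable_const 1) hS, integral_const, smul_eq_mul, mul_one,
            H.integral_sum_sq]
      _ ≤ P.real univ + ∑' k, ∫ ω, D k ω ^ 2 ∂P := by
          gcongr
          exact hD.sum_le_tsum _ fun k _ => integral_nonneg fun ω => sq_nonneg _
  filter_upwards [H.martingale_sum.submartingale.exists_ae_tendsto_of_bdd hbdd] with ω ⟨l, hl⟩
  refine ⟨l, ?_⟩
  simpa only [HasSum, SummationFilter.conditional_filter_eq_map_range, tendsto_map'_iff,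
    Function.comp_def, Finset.sum_apply] using hl

end IsL2MartingaleDifference

variable {P : Measure Ω} {ℱ : Filtration ℕ m0} {Y : ℕ → Ω → ℝ}

lemma integral_sub_condExp_sq_le [IsProbabilityMeasure P] {m : MeasurableSpace Ω} (hm : m ≤ m0)
    {X : Ω → ℝ} (hX : MemLp X 2 P) :
    ∫ ω, (X ω - (P[X|m]) ω) ^ 2 ∂P ≤ ∫ ω, X ω ^ 2 ∂P := by
  have hvar := integral_condVar_add_variance_condExp hm hX
  have hle := variance_le_expectation_sq hX.aestronglyMeasurable
  have hcond : ∫ ω, (X ω - (P[X|m]) ω) ^ 2 ∂P = ∫ ω, (Var[X; P | m]) ω ∂P :=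
    (integral_condExp hm).symm
  have hnonneg := variance_nonneg (P[X|m]) P
  simp only [Pi.pow_apply] at hle
  linarith

lemma isL2MartingaleDifference_mul_sub_condExp [IsFiniteMeasure P]
    (hmeas : ∀ n, StronglyMeasurable[ℱ (n + 1)] (Y n)) (hY : ∀ n, MemLp (Y n) 2 P) (a : ℕ → ℝ) :
    IsL2MartingaleDifference P ℱ fun n ω => a n * (Y n ω - (P[Y n|ℱ n]) ω) where
  stronglyMeasurable n := ((hmeas n).sub
    (stronglyMeasurable_condExp.mono (ℱ.mono n.le_succ))).const_mul _
  memLp n := ((hY n).sub ((hY n).condExp one_le_two)).const_mul _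
  condExp_ae_eq_zero n := by
    have hint := (hY n).integrable one_le_two
    have hsmul := condExp_smul (μ := P) (a n) (Y n - P[Y n|ℱ n]) (ℱ n)
    have hsub := condExp_sub hint (integrable_condExp (m := ℱ n) (f := Y n)) (ℱ n)
    have hidem := condExp_of_stronglyMeasurable (ℱ.le n) stronglyMeasurable_condExp
      (integrable_condExp (μ := P) (f := Y n))
    refine hsmul.trans ?_
    filter_upwards [hsub] with ω hω
    rw [Pi.smul_apply, hω, hidem, sub_self, Pi.zero_apply, smul_zero]

lemma ae_summable_mul_sub_condExp [IsProbabilityMeasure P]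
    (hmeas : ∀ n, StronglyMeasurable[ℱ (n + 1)] (Y n)) (hY : ∀ n, MemLp (Y n) 2 P) {R : ℝ}
    (hR : ∀ n, ∫ ω, Y n ω ^ 2 ∂P ≤ R) {a : ℕ → ℝ} (ha : Summable fun n => a n ^ 2) :
    ∀ᵐ ω ∂P, Summable (fun n => a n * (Y n ω - (P[Y n|ℱ n]) ω)) (.conditional ℕ) := by
  refine (isL2MartingaleDifference_mul_sub_condExp hmeas hY a).ae_summable <|
    (ha.mul_right R).of_nonneg_of_le (fun n => integral_nonneg fun ω => sq_nonneg _) fun n => ?_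
  simp only [mul_pow, integral_const_mul]
  gcongr
  exact (integral_sub_condExp_sq_le (ℱ.le n) (hY n)).trans (hR n)

lemma ae_summable_mul (hY : ∀ n, Integrable (Y n) P) {R : ℝ} (hR : ∀ n, ∫ ω, |Y n ω| ∂P ≤ R)
    {a : ℕ → ℝ} (ha : Summable fun n => |a n|) : ∀ᵐ ω ∂P, Summable fun n => a n * Y n ω := by
  have hle (n : ℕ) : eLpNorm (fun ω => a n * Y n ω) 1 P ≤ ENNReal.ofReal (|a n| * R) := by
    rw [eLpNorm_one_eq_lintegral_enorm,
      ← ofReal_integral_norm_eq_lintegral_enorm ((hY n).const_mul (a n))]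
    simp only [norm_mul, Real.norm_eq_abs, integral_const_mul]
    gcongr
    exact hR n
  have hfin : ∑' n, eLpNorm (fun ω => a n * Y n ω) 1 P ≠ ∞ :=
    ne_top_of_le_ne_top (ha.mul_right R).tsum_ofReal_ne_top (ENNReal.tsum_le_tsum hle)
  exact (summable_norm_of_tsum_eLpNorm_ne_top le_rfl
    (fun n => ((hY n).const_mul (a n)).aestronglyMeasurable) hfin).mono fun ω => Summable.of_norm

end MartingaleDifference

section SummationByParts

lemma tendsto_atTop_zero_of_summable_sq {a : ℕ → ℝ} (ha : Summable fun n => a n ^ 2) :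
    Tendsto a atTop (𝓝 0) := by
  have habs := ha.tendsto_atTop_zero.sqrt
  simp only [Real.sqrt_sq_eq_abs, Real.sqrt_zero] at habs
  exact (tendsto_zero_iff_abs_tendsto_zero a).2 habs

lemma summable_conditional_sub_succ {a : ℕ → ℝ} (ha : Tendsto a atTop (𝓝 0)) :
    Summable (fun n => a n - a (n + 1)) (.conditional ℕ) := by
  refine ⟨a 0 - 0, ?_⟩
  simp only [HasSum, SummationFilter.conditional_filter_eq_map_range, tendsto_map'_iff,
    Function.comp_def, Finset.sum_range_sub']
  exact ha.const_sub (a 0)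

variable {Z T : Type*} [MeasurableSpace Z] [MetricSpace T] {V : Z → ℝ} {γ : ℕ → ℝ}

lemma IsLipschitzFamily.summable_mul_sub {c L : ℝ} {u : T → Z → ℝ} (hu : IsLipschitzFamily V c L u)
    (hV : ∀ z, 0 ≤ V z) {t : ℕ → T} {w : ℕ → Z} {s : ℝ}
    (hstep : ∀ n, dist (t (n + 1)) (t n) ≤ s * |γ (n + 1)| * V (w (n + 1)))
    (hsq : Summable fun n => γ n ^ 2 * V (w n) ^ 2)
    (hvar : Summable fun n => |γ n - γ (n + 1)| * V (w n)) :
    Summable (fun n => γ (n + 1) * (u (t n) (w n) - u (t n) (w (n + 1)))) (.conditional ℕ) := by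
  have htelescope : Summable (fun n => γ n * u (t n) (w n) - γ (n + 1) * u (t (n + 1)) (w (n + 1)))
      (.conditional ℕ) := by
    refine summable_conditional_sub_succ (a := fun n => γ n * u (t n) (w n)) <|
      tendsto_atTop_zero_of_summable_sq <|
      (hsq.mul_left (c ^ 2)).of_nonneg_of_le (fun n => sq_nonneg _) fun n => ?_
    calc (γ n * u (t n) (w n)) ^ 2 = γ n ^ 2 * |u (t n) (w n)| ^ 2 := by rw [mul_pow, sq_abs]
      _ ≤ γ n ^ 2 * (c * V (w n)) ^ 2 := by
          gcongr
          exact (hu.isDominated (t n)).abs_le (w n)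
      _ = c ^ 2 * (γ n ^ 2 * V (w n) ^ 2) := by ring
  have hstepsize : Summable fun n => (γ (n + 1) - γ n) * u (t n) (w n) := by
    refine .of_norm_bounded (hvar.mul_left c) fun n => ?_
    calc ‖(γ (n + 1) - γ n) * u (t n) (w n)‖ = |γ n - γ (n + 1)| * |u (t n) (w n)| := by
          rw [Real.norm_eq_abs, abs_mul, abs_sub_comm]
      _ ≤ |γ n - γ (n + 1)| * (c * V (w n)) := by
          gcongr
          exact (hu.isDominated (t n)).abs_le (w n)
      _ = c * (|γ n - γ (n + 1)| * V (w n)) := by ring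
  have hparam : Summable fun n =>
      γ (n + 1) * (u (t (n + 1)) (w (n + 1)) - u (t n) (w (n + 1))) := by
    refine .of_norm_bounded (((summable_nat_add_iff 1).2 hsq).mul_left (|L| * s)) fun n => ?_
    have hw := hV (w (n + 1))
    calc ‖γ (n + 1) * (u (t (n + 1)) (w (n + 1)) - u (t n) (w (n + 1)))‖
        = |γ (n + 1)| * |u (t (n + 1)) (w (n + 1)) - u (t n) (w (n + 1))| := by
          rw [Real.norm_eq_abs, abs_mul]
      _ ≤ |γ (n + 1)| * (L * dist (t (n + 1)) (t n) * V (w (n + 1))) := by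
          gcongr
          exact (hu.isDominated_sub _ _).abs_le _
      _ ≤ |γ (n + 1)| * (|L| * (s * |γ (n + 1)| * V (w (n + 1))) * V (w (n + 1))) := by
          gcongr
          exacts [le_abs_self L, hstep n]
      _ = |L| * s * (γ (n + 1) ^ 2 * V (w (n + 1)) ^ 2) := by
          rw [← sq_abs (γ (n + 1))]
          ring
  convert (htelescope.add (hstepsize.mono_filter (SummationFilter.conditional ℕ).le_atTop)).add
    (hparam.mono_filter (SummationFilter.conditional ℕ).le_atTop) using 2
  ring

end SummationByParts

section Noise

variable {Ω Z T : Type*} {m0 : MeasurableSpace Ω} {P : Measure Ω} [IsProbabilityMeasure P]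
  {ℱ : Filtration ℕ m0} [MeasurableSpace Z] [MeasurableSpace T] {κ : Kernel (T × Z) Z}
  [IsMarkovKernel κ] {x : ℕ → Ω → T} {z : ℕ → Ω → Z} {V : Z → ℝ} {γ : ℕ → ℝ} {R : ℝ}

lemma IsControlledChain.ae_summable_mul_sub_integral (H : IsControlledChain P ℱ κ x z)
    (hmem : ∀ n, MemLp (fun ω => V (z n ω)) 2 P) (hR : ∀ n, ∫ ω, V (z n ω) ^ 2 ∂P ≤ R) {c : ℝ}
    {G : T → Z → ℝ} (hG : Measurable (Function.uncurry G)) (hGV : ∀ t, IsDominated V c (G t))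
    (hγ : Summable fun n => γ n ^ 2) :
    ∀ᵐ ω ∂P, Summable (fun n => γ n * (G (x n ω) (z (n + 1) ω) -
      ∫ y, G (x n ω) y ∂(κ (x n ω, z n ω)))) (.conditional ℕ) := by
  have hmeas (n : ℕ) : StronglyMeasurable[ℱ (n + 1)] fun ω => G (x n ω) (z (n + 1) ω) :=
    (hG.comp (((H.measurable_param n).mono (ℱ.mono n.le_succ) le_rfl).prodMk
      (H.measurable_state (n + 1)))).stronglyMeasurable
  have hle (n : ℕ) (ω : Ω) := (hGV (x n ω)).abs_le (z (n + 1) ω)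
  have hGmem (n : ℕ) : MemLp (fun ω => G (x n ω) (z (n + 1) ω)) 2 P :=
    ((hmem (n + 1)).const_mul c).mono' ((hmeas n).mono (ℱ.le _)).aestronglyMeasurable
      (ae_of_all _ (hle n))
  have hGsq (n : ℕ) : ∫ ω, G (x n ω) (z (n + 1) ω) ^ 2 ∂P ≤ c ^ 2 * R :=
    calc ∫ ω, G (x n ω) (z (n + 1) ω) ^ 2 ∂P ≤ ∫ ω, c ^ 2 * V (z (n + 1) ω) ^ 2 ∂P :=
          integral_mono (hGmem n).integrable_sq ((hmem (n + 1)).integrable_sq.const_mul _)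
            fun ω => by
              simp only [← mul_pow]
              exact sq_le_sq.2 ((hle n ω).trans (le_abs_self _))
      _ ≤ c ^ 2 * R := by
          rw [integral_const_mul]
          gcongr
          exact hR (n + 1)
  have hcond := ae_all_iff.2 fun n => (H.hasCondLaw n).condExp_ae_eq
    (F := fun q => G q.1.1 q.2) (hG.comp ((measurable_fst.comp measurable_fst).prodMk
      measurable_snd)) ((hGmem n).integrable one_le_two)
  filter_upwards [hcond, ae_summable_mul_sub_condExp hmeas hGmem hGsq hγ] with ω hω hsum
  simpa only [hω] using hsum

theorem IsControlledChain.ae_summable_mul_noise [MetricSpace T] [SecondCountableTopology T]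
    [OpensMeasurableSpace T] (H : IsControlledChain P ℱ κ x z) {Q : T → Kernel Z Z}
    {μ : T → Measure Z} {C ρ B D : ℝ}
    (hQ : IsErgodicFamily V Q μ C ρ B D) (hκ : ∀ t, κ.sectR t = Q t) {c L : ℝ} {h : T → Z → ℝ}
    (hh : IsLipschitzFamily V c L h) (hmem : ∀ n, MemLp (fun ω => V (z n ω)) 2 P)
    (hR : ∀ n, ∫ ω, V (z n ω) ^ 2 ∂P ≤ R) (hvar : Summable fun n => |γ n - γ (n + 1)|)
    (hsq : Summable fun n => γ n ^ 2) {s : ℝ}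
    (hstep : ∀ n ω, dist (x (n + 1) ω) (x n ω) ≤ s * |γ (n + 1)| * V (z (n + 1) ω)) :
    ∀ᵐ ω ∂P, Summable (fun n => γ (n + 1) * (h (x n ω) (z (n + 1) ω) -
      ∫ y, h (x n ω) y ∂(μ (x n ω)))) (.conditional ℕ) := by
  have hpoisson := hQ.isLipschitzFamily_poisson hh
  obtain ⟨c', L', hkernel⟩ := hQ.isLipschitzFamily_integral_poisson hh
  have hmartingale := H.ae_summable_mul_sub_integral hmem hR hpoisson.measurable_uncurry
    hpoisson.isDominated ((summable_nat_add_iff 1).2 hsq)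
  have hmean (n : ℕ) : ∫ ω, |V (z n ω)| ∂P ≤ R :=
    (integral_mono ((hmem n).integrable one_le_two).abs (hmem n).integrable_sq fun ω => by
      have hV := (hQ.isGeomErgodic (x n ω)).one_le_weight (z n ω)
      simp only [abs_of_pos (zero_lt_one.trans_le hV)]
      exact le_self_pow₀ hV two_ne_zero).trans (hR n)
  have hsqV := ae_summable_mul (a := fun n => γ n ^ 2) (fun n => (hmem n).integrable_sq)
    (fun n => by simpa only [abs_sq] using hR n) (by simpa only [abs_sq] using hsq)
  have hvarV := ae_summable_mul (a := fun n => |γ n - γ (n + 1)|)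
    (fun n => (hmem n).integrable one_le_two) hmean (by simpa only [abs_abs] using hvar)
  filter_upwards [hmartingale, hsqV, hvarV] with ω hω hsqω hvarω
  have hV (z : Z) : 0 ≤ V z := ((hQ.isGeomErgodic (x 0 ω)).weight_pos z).le
  have hκω (n : ℕ) (z : Z) : κ (x n ω, z) = Q (x n ω) z := by rw [← hκ, Kernel.sectR_apply]
  convert hω.add (hkernel.summable_mul_sub hV (t := fun n => x n ω) (w := fun n => z n ω)
    (fun n => hstep n ω) hsqω hvarω) using 2 with n
  rw [← (hQ.isGeomErgodic (x n ω)).poisson_sub_integral_poisson (hh.isDominated (x n ω)), hκω]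
  ring

end Noise

section LinearMinorant

variable {E : Type*} [PseudoMetricSpace E] {X K : Set E} {g : E → ℝ}

lemma exists_mem_nhdsWithin_sub_le_mul_dist (hg : LocallyLipschitzOn X g) {m : ℝ}
    (hm : ∀ a ∈ X, m ≤ g a) {x₀ : E} (hx₀ : x₀ ∈ X) :
    ∃ t ∈ 𝓝[X] x₀, ∃ L : ℝ, 0 ≤ L ∧ ∀ x ∈ t, ∀ a ∈ X, g x - g a ≤ L * dist x a := by
  obtain ⟨C, s, hs, hC⟩ := hg hx₀
  obtain ⟨ε, hε, hεs⟩ := Metric.mem_nhdsWithin_iff.1 hs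
  have hlip {x y : E} (hx : x ∈ s) (hy : y ∈ s) : g x - g y ≤ C * dist x y :=
    (le_abs_self _).trans (hC.dist_le_mul x hx y hy)
  set A := (g x₀ + C * ε - m) / (ε / 2)
  have hA : 0 ≤ A := by
    have := hm x₀ hx₀
    exact div_nonneg (by nlinarith [C.coe_nonneg]) (by positivity)
  refine ⟨Metric.ball x₀ (ε / 2) ∩ X, inter_mem (mem_nhdsWithin_of_mem_nhds
    (Metric.ball_mem_nhds _ (by positivity))) self_mem_nhdsWithin, C + A, by positivity, ?_⟩
  rintro x ⟨hx, hxX⟩ a ha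
  have hdist : dist x x₀ < ε / 2 := hx
  have hxs : x ∈ s := hεs ⟨Metric.ball_subset_ball (by linarith) hx, hxX⟩
  have hCdist : 0 ≤ C * dist x a := by positivity
  have hAdist : 0 ≤ A * dist x a := by positivity
  rw [add_mul]
  rcases lt_or_ge (dist x a) (ε / 2) with hnear | hfar
  · have has : a ∈ s := hεs ⟨by
      rw [Metric.mem_ball]
      linarith [dist_triangle_left a x₀ x], ha⟩
    linarith [hlip hxs has]
  · have hx₀s : x₀ ∈ s := hεs ⟨Metric.mem_ball_self hε, hx₀⟩
    have hgx : g x - g x₀ ≤ C * ε :=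
      (hlip hxs hx₀s).trans (mul_le_mul_of_nonneg_left (by linarith) C.coe_nonneg)
    calc g x - g a ≤ g x₀ + C * ε - m := by linarith [hm a ha]
      _ = A * (ε / 2) := (div_mul_cancel₀ _ (by positivity)).symm
      _ ≤ A * dist x a := by gcongr
      _ ≤ C * dist x a + A * dist x a := le_add_of_nonneg_left hCdist

lemma exists_sub_le_mul_dist (hg : LocallyLipschitzOn X g) (hbdd : BddBelow (g '' X))
    (hK : IsCompact K) (hKX : K ⊆ X) :
    ∃ L : ℝ, 0 ≤ L ∧ ∀ x ∈ K, ∀ a ∈ X, g x - g a ≤ L * dist x a := by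
  obtain ⟨m, hm⟩ := hbdd
  refine hK.induction_on (p := fun s => ∃ L : ℝ, 0 ≤ L ∧ ∀ x ∈ s, ∀ a ∈ X,
    g x - g a ≤ L * dist x a) ⟨0, le_rfl, by simp⟩
    (fun s t hst ⟨L, hL, h⟩ => ⟨L, hL, fun x hx => h x (hst hx)⟩)
    (fun s t ⟨L, hL, h⟩ ⟨L', _, h'⟩ => ⟨max L L', le_max_of_le_left hL, ?_⟩) fun x₀ hx₀ => ?_
  · rintro x (hx | hx) a ha
    · exact (h x hx a ha).trans (mul_le_mul_of_nonneg_right (le_max_left _ _) dist_nonneg)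
    · exact (h' x hx a ha).trans (mul_le_mul_of_nonneg_right (le_max_right _ _) dist_nonneg)
  · obtain ⟨t, ht, hLt⟩ := exists_mem_nhdsWithin_sub_le_mul_dist hg
      (fun a ha => hm (mem_image_of_mem g ha)) (hKX hx₀)
    exact ⟨t, nhdsWithin_mono x₀ hKX ht, hLt⟩

end LinearMinorant

section Prox

variable {E : Type*} [NormedAddCommGroup E] {X K : Set E} {g : E → ℝ}
  {γ L : ℝ} {x y v : E}

lemma prox_add_convexIndicator_subset (hK : K.Nonempty) (hKX : K ⊆ X) :
    prox X γ (fun y => (g y : EReal) + convexIndicator K y) v ⊆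
      prox K γ (fun y => (g y : EReal)) v := by
  intro y hy
  have hmem {a : E} (ha : a ∈ K) : convexIndicator K a = 0 := if_pos ha
  have hyK : y ∈ K := by
    by_contra hyK
    obtain ⟨x, hx⟩ := hK
    have hle := hy.2 x (hKX hx)
    have hyTop : convexIndicator K y = ⊤ := if_neg hyK
    simp only [hmem hx, hyTop, add_zero, EReal.coe_add_top, EReal.top_add_coe, top_le_iff,
      ← EReal.coe_add] at hle
    exact EReal.coe_ne_top _ hle
  refine ⟨hyK, fun a ha => ?_⟩
  simpa only [hmem hyK, hmem ha, add_zero] using hy.2 a (hKX ha)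

lemma norm_sub_le_of_mem_projSet {A : Set E} {r : ℝ} (hx : x ∈ K) (hA : ∀ a ∈ A, ‖a - x‖ ≤ r)
    (hy : y ∈ projSet K A) : ‖y - x‖ ≤ 2 * r := by
  obtain ⟨a, ha, -, hmin⟩ := hy
  have htriangle := norm_sub_le_norm_sub_add_norm_sub y a x
  rw [norm_sub_rev y a] at htriangle
  linarith [hmin x hx, hA a ha]

variable [InnerProductSpace ℝ E]

lemma norm_sub_le_of_mem_prox (hγ : 0 < γ) (hL0 : 0 ≤ L) (hx : x ∈ X)
    (hL : ∀ a ∈ X, g x - g a ≤ L * dist x a)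
    (hy : y ∈ prox X γ (fun y => (g y : EReal)) (x - γ • v)) : ‖y - x‖ ≤ 2 * γ * (L + ‖v‖) := by
  have hmin : g y + (2 * γ)⁻¹ * ‖y - (x - γ • v)‖ ^ 2 ≤ g x + (2 * γ)⁻¹ * (γ * ‖v‖) ^ 2 := by
    have h := hy.2 x hx
    rw [sub_sub_cancel, norm_smul, Real.norm_of_nonneg hγ.le] at h
    dsimp only at h
    exact_mod_cast h
  have hexpand : ‖y - x‖ ^ 2 - 2 * γ * (‖y - x‖ * ‖v‖) + (γ * ‖v‖) ^ 2 ≤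
      ‖y - (x - γ • v)‖ ^ 2 := by
    rw [← sub_add, norm_add_sq_real, real_inner_smul_right, norm_smul, Real.norm_of_nonneg hγ.le]
    nlinarith [neg_le_of_abs_le (abs_real_inner_le_norm (y - x) v)]
  have hgap : (2 * γ)⁻¹ * (‖y - x‖ ^ 2 - 2 * γ * (‖y - x‖ * ‖v‖)) ≤ L * ‖y - x‖ := by
    have hscaled := mul_le_mul_of_nonneg_left hexpand (inv_nonneg.2 (by positivity : 0 ≤ 2 * γ))
    have hgL := hL y hy.1
    rw [dist_comm, dist_eq_norm] at hgL
    linarith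
  rw [inv_mul_le_iff₀ (by positivity)] at hgap
  rcases (norm_nonneg (y - x)).eq_or_lt with hzero | hpos
  · rw [← hzero]
    positivity
  · exact le_of_mul_le_mul_right (by linarith) hpos

lemma mem_and_norm_sub_le_of_proxScheme (hL0 : 0 ≤ L)
    (hL : ∀ x ∈ K, ∀ a ∈ X, g x - g a ≤ L * dist x a) (hKX : K ⊆ X) {γ : ℕ → ℝ}
    (hγ : ∀ k, 1 ≤ k → 0 < γ k) {x H : ℕ → E} (hx0 : x 0 ∈ K)
    (hx : IndicatorProxScheme X K g γ x H ∨ ProjectedProxScheme X K g γ x H) (k : ℕ) :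
    x k ∈ K ∧ ‖x (k + 1) - x k‖ ≤ 4 * γ (k + 1) * (L + ‖H (k + 1)‖) := by
  have hstep (k : ℕ) (hk : x k ∈ K) :
      x (k + 1) ∈ K ∧ ‖x (k + 1) - x k‖ ≤ 4 * γ (k + 1) * (L + ‖H (k + 1)‖) := by
    have hγk := hγ (k + 1) (Nat.le_add_left 1 k)
    have hbound : 0 ≤ γ (k + 1) * (L + ‖H (k + 1)‖) := by positivity
    rcases hx with hprox | hproj
    · have hmem := prox_add_convexIndicator_subset ⟨x k, hk⟩ hKX (hprox k)
      have hle := norm_sub_le_of_mem_prox hγk hL0 hk (fun a ha => hL _ hk a (hKX ha)) hmem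
      exact ⟨hmem.1, by linarith⟩
    · have hle := norm_sub_le_of_mem_projSet hk
        (fun a ha => norm_sub_le_of_mem_prox hγk hL0 (hKX hk) (hL _ hk) ha) (hproj k)
      obtain ⟨-, -, hmem, -⟩ := hproj k
      exact ⟨hmem, by linarith⟩
  have hmem : x k ∈ K := by
    induction k with
    | zero => exact hx0
    | succ k ih => exact (hstep k ih).1
  exact ⟨hmem, (hstep k hmem).2⟩

end Prox

section VectorNoise

variable {Z T E : Type*} [MeasurableSpace Z] [MetricSpace T] [NormedAddCommGroup E]
  [InnerProductSpace ℝ E] [MeasurableSpace E] [BorelSpace E] {V : Z → ℝ} {c L : ℝ} {Φ : T → Z → E}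

lemma isDominated_inner (hc : 0 ≤ c) {φ : Z → E} (hφ : Measurable φ)
    (hle : ∀ z, ‖φ z‖ ≤ c * V z) (v : E) : IsDominated V (‖v‖ * c) fun z => inner ℝ v (φ z) where
  nonneg := mul_nonneg (norm_nonneg v) hc
  measurable := (innerSL ℝ v).measurable.comp hφ
  abs_le z := by
    rw [mul_assoc]
    exact (abs_real_inner_le_norm v (φ z)).trans
      (mul_le_mul_of_nonneg_left (hle z) (norm_nonneg v))

lemma isLipschitzFamily_inner [SecondCountableTopology E] (hc : 0 ≤ c) (hL : 0 ≤ L)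
    (hΦ : ∀ t, Measurable (Φ t)) (hle : ∀ t z, ‖Φ t z‖ ≤ c * V z)
    (hlip : ∀ t t' z, ‖Φ t z - Φ t' z‖ ≤ L * dist t t' * V z) (v : E) :
    IsLipschitzFamily V (‖v‖ * c) (‖v‖ * L) fun t z => inner ℝ v (Φ t z) where
  isDominated t := isDominated_inner hc (hΦ t) (hle t) v
  isDominated_sub t t' := by
    simpa only [mul_assoc, Pi.sub_apply, inner_sub_right] using
      isDominated_inner (mul_nonneg hL dist_nonneg) ((hΦ t).sub (hΦ t')) (hlip t t') v

theorem IsControlledChain.ae_summable_smul_noise [FiniteDimensional ℝ E] {Ω : Type*}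
    {m0 : MeasurableSpace Ω} {P : Measure Ω} [IsProbabilityMeasure P] {ℱ : Filtration ℕ m0}
    [SecondCountableTopology T] [MeasurableSpace T] [OpensMeasurableSpace T]
    {κ : Kernel (T × Z) Z} [IsMarkovKernel κ] {x : ℕ → Ω → T} {z : ℕ → Ω → Z}
    (H : IsControlledChain P ℱ κ x z) {Q : T → Kernel Z Z} {μ : T → Measure Z} {C ρ B D : ℝ}
    (hQ : IsErgodicFamily V Q μ C ρ B D) (hκ : ∀ t, κ.sectR t = Q t) (hc : 0 ≤ c) (hL : 0 ≤ L)
    (hΦ : ∀ t, Measurable (Φ t)) (hle : ∀ t z, ‖Φ t z‖ ≤ c * V z)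
    (hlip : ∀ t t' z, ‖Φ t z - Φ t' z‖ ≤ L * dist t t' * V z)
    (hmem : ∀ n, MemLp (fun ω => V (z n ω)) 2 P) {R : ℝ} (hR : ∀ n, ∫ ω, V (z n ω) ^ 2 ∂P ≤ R)
    {γ : ℕ → ℝ} (hvar : Summable fun n => |γ n - γ (n + 1)|) (hsq : Summable fun n => γ n ^ 2)
    {s : ℝ} (hstep : ∀ n ω, dist (x (n + 1) ω) (x n ω) ≤ s * |γ (n + 1)| * V (z (n + 1) ω)) :
    ∀ᵐ ω ∂P, Summable (fun n => γ (n + 1) • (Φ (x n ω) (z (n + 1) ω) -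
      ∫ y, Φ (x n ω) y ∂(μ (x n ω)))) (.conditional ℕ) := by
  have hcoord := ae_all_iff.2 fun i => H.ae_summable_mul_noise hQ hκ
    (isLipschitzFamily_inner hc hL hΦ hle hlip (stdOrthonormalBasis ℝ E i)) hmem hR hvar hsq hstep
  filter_upwards [hcoord] with ω hω
  have hint (t : T) : Integrable (Φ t) (μ t) :=
    ((hQ.isGeomErgodic t).integrable_weight.const_mul c).mono' (hΦ t).aestronglyMeasurable
      (ae_of_all _ (hle t))
  convert summable_sum fun i (_ : i ∈ Finset.univ) =>
    (hω i).smul_const (stdOrthonormalBasis ℝ E i) using 2 with n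
  rw [← (stdOrthonormalBasis ℝ E).sum_repr' (γ (n + 1) • _)]
  simp only [integral_inner (hint _), inner_smul_right, inner_sub_right]

end VectorNoise

section Series

variable {E : Type*} [NormedAddCommGroup E]

lemma seriesConverges_of_summable_conditional {v : ℕ → E}
    (hv : Summable (fun n => v (n + 2)) (.conditional ℕ)) : SeriesConverges v := by
  obtain ⟨l, hl⟩ := hv
  simp only [HasSum, SummationFilter.conditional_filter_eq_map_range, tendsto_map'_iff,
    Function.comp_def] at hl
  refine ⟨v 1 + l, (tendsto_add_atTop_iff_nat 1).1 ((hl.const_add (v 1)).congr fun n => ?_)⟩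
  rw [← Finset.Ico_succ_right_eq_Icc, Finset.sum_Ico_eq_sum_range, Order.succ_eq_add_one,
    Nat.add_sub_cancel, Finset.sum_range_succ', add_comm]
  simp only [add_comm 1, add_assoc, zero_add, one_add_one_eq_two]

lemma SeriesConverges.noiseCondition [InnerProductSpace ℝ E] {γ : ℕ → ℝ} {δ : ℕ → E}
    (h : SeriesConverges fun k => γ k • δ k) : NoiseCondition γ δ :=
  ⟨δ, fun _ => 0, fun k _ => (add_zero (δ k)).symm, by simp, h⟩

end Series

section Assumptions

lemma IsControlledChain.exists_memLp_two_weight {Ω Z T : Type*} {m0 : MeasurableSpace Ω}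
    [MeasurableSpace Z] [MeasurableSpace T] {P : Measure Ω} [IsProbabilityMeasure P]
    {ℱ : Filtration ℕ m0} {κ : Kernel (T × Z) Z} [IsMarkovKernel κ] {x : ℕ → Ω → T}
    {z : ℕ → Ω → Z} (H : IsControlledChain P ℱ κ x z) {V : Z → ℝ} (hV : Measurable V) {a b : ℝ}
    (ha : a < 1)
    (hdrift : ∀ t z, ∫⁻ y, ENNReal.ofReal (V y ^ 2) ∂(κ (t, z)) ≤ ENNReal.ofReal (a * V z ^ 2 + b))
    (h0 : Integrable (fun ω => V (z 0 ω) ^ 2) P) :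
    ∃ R : ℝ, ∀ n, MemLp (fun ω => V (z n ω)) 2 P ∧ ∫ ω, V (z n ω) ^ 2 ∂P ≤ R := by
  set R := ∫⁻ ω, ENNReal.ofReal (V (z 0 ω) ^ 2) ∂P + ENNReal.ofReal b / (1 - ENNReal.ofReal a)
  have ha' : ENNReal.ofReal a < 1 := ENNReal.ofReal_lt_one.2 ha
  have hR (n : ℕ) : ∫⁻ ω, ENNReal.ofReal (V (z n ω) ^ 2) ∂P ≤ R :=
    H.lintegral_weight_le (hV.pow_const 2).ennreal_ofReal ha' (fun t z => by
      rw [← ENNReal.ofReal_mul' (sq_nonneg (V z))]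
      exact (hdrift t z).trans ENNReal.ofReal_add_le) n
  have hR_top : R < ⊤ := ENNReal.add_lt_top.2
    ⟨h0.lintegral_lt_top, ENNReal.div_lt_top ENNReal.ofReal_ne_top (tsub_pos_of_lt ha').ne'⟩
  refine ⟨R.toReal, fun n => ?_⟩
  have hmeas : AEStronglyMeasurable (fun ω => V (z n ω)) P :=
    (hV.comp ((H.measurable_state n).mono (ℱ.le n) le_rfl)).aestronglyMeasurable
  have hnonneg : 0 ≤ᵐ[P] fun ω => V (z n ω) ^ 2 := ae_of_all _ fun ω => sq_nonneg _
  refine ⟨(memLp_two_iff_integrable_sq hmeas).2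
    ⟨hmeas.pow 2, (hasFiniteIntegral_iff_ofReal hnonneg).2 ((hR n).trans_lt hR_top)⟩, ?_⟩
  rw [integral_eq_lintegral_of_nonneg_ae hnonneg (hmeas.pow 2)]
  exact ENNReal.toReal_mono hR_top.ne (hR n)

/-- The filtration `ℱ 1, ℱ 2, …`: the samples start at `z 1`, so the chain does not see `ℱ 0`. -/
def shiftedFiltration {Ω : Type*} {m0 : MeasurableSpace Ω} (ℱ : Filtration ℕ m0) :
    Filtration ℕ m0 where
  seq n := ℱ (n + 1)
  mono' _ _ hij := ℱ.mono (Nat.succ_le_succ hij)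
  le' n := ℱ.le (n + 1)

lemma MarkovianDynamic.isControlledChain {Ω Z E : Type*} {m0 : MeasurableSpace Ω}
    [MeasurableSpace Z] [MeasurableSpace E] {K : Set E} {M : E → Kernel Z Z} {P : Measure Ω}
    {ℱ : Filtration ℕ m0} {x : ℕ → Ω → E} {z : ℕ → Ω → Z}
    (h : MarkovianDynamic P ℱ M x z) (hx : ∀ k ω, x k ω ∈ K) {κ : Kernel (K × Z) Z}
    (hκ : ∀ t : K, κ.sectR t = M t) :
    IsControlledChain P (shiftedFiltration ℱ) κ (fun n ω => ⟨x (n + 1) ω, hx (n + 1) ω⟩)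
      fun n => z (n + 1) where
  measurable_param n := (h.measurable_param (n + 1)).subtype_mk
  measurable_state n := h.measurable_sample (n + 1) (Nat.le_add_left 1 n)
  transition n A hA := by
    simp only [← Kernel.sectR_apply, hκ]
    exact h.transition (n + 1) (Nat.le_add_left 1 n) A hA

lemma isMarkovKernel_of_sectR {T Z : Type*} [MeasurableSpace T] [MeasurableSpace Z]
    {κ : Kernel (T × Z) Z} (h : ∀ t, IsMarkovKernel (κ.sectR t)) : IsMarkovKernel κ where
  isProbabilityMeasure q := (h q.1).isProbabilityMeasure q.2

variable {Z E : Type*} [MeasurableSpace Z] [NormedAddCommGroup E] {K : Set E} {Φ : E → Z → E}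
  {M : E → Kernel Z Z} {π : E → Measure Z} {W : Z → ℝ}

lemma UniformlyErgodic.one_le_rpow (h : UniformlyErgodic K Φ M π W) (z : Z) :
    1 ≤ W z ^ (1 / 2 : ℝ) :=
  Real.one_le_rpow (h.one_le_weight z) (by norm_num)

lemma UniformlyErgodic.rpow_sq (h : UniformlyErgodic K Φ M π W) (z : Z) :
    (W z ^ (1 / 2 : ℝ)) ^ 2 = W z := by
  rw [← Real.sqrt_eq_rpow, Real.sq_sqrt (zero_le_one.trans (h.one_le_weight z))]

lemma UniformlyErgodic.exists_norm_le (h : UniformlyErgodic K Φ M π W) :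
    ∃ c : ℝ, 0 ≤ c ∧ ∀ x ∈ K, ∀ z, ‖Φ x z‖ ≤ c * W z ^ (1 / 2 : ℝ) := by
  refine ⟨(⨆ x ∈ K, wNorm (fun z => W z ^ (1 / 2 : ℝ)) (Φ x)).toReal, ENNReal.toReal_nonneg,
    fun x hx z => norm_le_of_wNorm_le (V := fun z => W z ^ (1 / 2 : ℝ))
      (zero_lt_one.trans_le (h.one_le_rpow z)) ENNReal.toReal_nonneg ?_⟩
  rw [ENNReal.ofReal_toReal h.gradient_bound.ne]
  exact le_iSup₂ (f := fun x _ => wNorm (fun z => W z ^ (1 / 2 : ℝ)) (Φ x)) x hx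

lemma UniformlyErgodic.exists_memLp_two [MeasurableSpace E] {Ω : Type*} {m0 : MeasurableSpace Ω}
    {P : Measure Ω} [IsProbabilityMeasure P] {ℱ : Filtration ℕ m0} {κ : Kernel (K × Z) Z}
    [IsMarkovKernel κ] {x : ℕ → Ω → K} {z : ℕ → Ω → Z} (h : UniformlyErgodic K Φ M π W)
    (hκ : ∀ t : K, κ.sectR t = M t) (H : IsControlledChain P ℱ κ x z)
    (h0 : Integrable (fun ω => W (z 0 ω)) P) :
    ∃ R : ℝ, ∀ n, MemLp (fun ω => W (z n ω) ^ (1 / 2 : ℝ)) 2 P ∧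
      ∫ ω, (W (z n ω) ^ (1 / 2 : ℝ)) ^ 2 ∂P ≤ R := by
  obtain ⟨lam, b, -, hlam, hdrift⟩ := h.drift
  refine H.exists_memLp_two_weight (h.measurable_weight.pow_const _) hlam (b := b)
    (fun t y => ?_) ?_
  · simp only [h.rpow_sq, ← Kernel.sectR_apply, hκ]
    exact (le_iSup₂ (f := fun x _ => ∫⁻ y', ENNReal.ofReal (W y') ∂(M x y)) t.1 t.2).trans
      (hdrift y)
  · simpa only [h.rpow_sq] using h0

lemma LipschitzInParameter.exists_nonneg (h : LipschitzInParameter K Φ M W) :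
    ∃ D : ℝ, 0 ≤ D ∧ ∀ x ∈ K, ∀ x' ∈ K,
      wNorm (fun z => W z ^ (1 / 2 : ℝ)) (fun z => Φ x z - Φ x' z) ≤
        ENNReal.ofReal (D * dist x x') ∧
      kernelWVariation (fun z => W z ^ (1 / 2 : ℝ)) (M x) (M x') ≤
        ENNReal.ofReal (D * dist x x') := by
  obtain ⟨C, hC⟩ := h
  refine ⟨max C 0, le_max_right C 0, fun x hx x' hx' => ?_⟩
  have hle : ENNReal.ofReal (C * ‖x - x'‖) ≤ ENNReal.ofReal (max C 0 * dist x x') := by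
    rw [dist_eq_norm]
    gcongr
    exact le_max_left C 0
  exact ⟨le_self_add.trans ((hC x hx x' hx').trans hle),
    le_add_self.trans ((hC x hx x' hx').trans hle)⟩

lemma UniformlyErgodic.exists_isErgodicFamily [Nonempty Z] (h : UniformlyErgodic K Φ M π W)
    (hlip : LipschitzInParameter K Φ M W) (hM : ∀ x ∈ K, IsMarkovKernel (M x))
    (hπ : ∀ x ∈ K, IsProbabilityMeasure (π x)) (hMπ : ∀ x ∈ K, Kernel.Invariant (M x) (π x)) :
    ∃ C ρ B D : ℝ, IsErgodicFamily (fun z => W z ^ (1 / 2 : ℝ)) (fun t : K => M t)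
      (fun t : K => π t) C ρ B D := by
  obtain ⟨C, ρ, hρ0, hρ1, hC⟩ := h.ergodic (1 / 2) (by norm_num) (by norm_num)
  obtain ⟨D, hD0, hD⟩ := hlip.exists_nonneg
  have hV0 (z : Z) : 0 ≤ W z ^ (1 / 2 : ℝ) := zero_le_one.trans (h.one_le_rpow z)
  have hgeom (t : K) :
      IsGeomErgodic (fun z => W z ^ (1 / 2 : ℝ)) (M t) (π t) (max C 0) ρ :=
    { measurable_weight := h.measurable_weight.pow_const _
      one_le_weight := h.one_le_rpow
      isMarkovKernel := hM t t.2
      isProbabilityMeasure := hπ t t.2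
      invariant := hMπ t t.2
      const_nonneg := le_max_right C 0
      rate_nonneg := hρ0.le
      rate_lt_one := hρ1
      wVariation_pow_le := fun n z =>
        (le_iSup₂ (f := fun x _ => wVariation (fun y => W y ^ (1 / 2 : ℝ)) ((M x ^ n) z) (π x))
          t.1 t.2).trans <| (hC n z).trans <| by
            have := hV0 z
            gcongr
            exact le_max_left C 0 }
  exact ⟨max C 0, ρ, (1 + max C 0) * W (Classical.arbitrary Z) ^ (1 / 2 : ℝ), D,
    { isGeomErgodic := hgeom
      integral_weight_le := fun t => ((hgeom t).integrable_and_integral_le _).2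
      lipschitz_nonneg := hD0
      kernelWVariation_le := fun t t' => (hD t t.2 t' t'.2).2 }⟩

lemma UniformlyErgodic.exists_isMarkovKernel_sectR_eq [MeasurableSpace E] [BorelSpace E]
    [SecondCountableTopology E] [Nonempty Z] (h : UniformlyErgodic K Φ M π W)
    (hlip : LipschitzInParameter K Φ M W) (hM : ∀ x ∈ K, IsMarkovKernel (M x))
    (hπ : ∀ x ∈ K, IsProbabilityMeasure (π x)) (hMπ : ∀ x ∈ K, Kernel.Invariant (M x) (π x)) :
    ∃ κ : Kernel (K × Z) Z, IsMarkovKernel κ ∧ ∀ t : K, κ.sectR t = M t := by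
  obtain ⟨C, ρ, B, D, hQ⟩ := h.exists_isErgodicFamily hlip hM hπ hMπ
  obtain ⟨κ, hκ⟩ := hQ.exists_kernel_sectR_eq
  refine ⟨κ, isMarkovKernel_of_sectR fun t => ?_, hκ⟩
  rw [hκ]
  exact hM t t.2

theorem UniformlyErgodic.ae_summable_smul_noise [InnerProductSpace ℝ E] [FiniteDimensional ℝ E]
    [MeasurableSpace E] [BorelSpace E] [Nonempty Z] (h : UniformlyErgodic K Φ M π W)
    (hlip : LipschitzInParameter K Φ M W) (hM : ∀ x ∈ K, IsMarkovKernel (M x))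
    (hπ : ∀ x ∈ K, IsProbabilityMeasure (π x)) (hMπ : ∀ x ∈ K, Kernel.Invariant (M x) (π x))
    (hΦ : ∀ x ∈ K, Measurable (Φ x)) {Ω : Type*} {m0 : MeasurableSpace Ω} {P : Measure Ω}
    [IsProbabilityMeasure P] {ℱ : Filtration ℕ m0} {κ : Kernel (K × Z) Z} [IsMarkovKernel κ]
    {x : ℕ → Ω → K} {z : ℕ → Ω → Z} (hκ : ∀ t : K, κ.sectR t = M t)
    (H : IsControlledChain P ℱ κ x z) (h0 : Integrable (fun ω => W (z 0 ω)) P) {γ : ℕ → ℝ}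
    (hvar : Summable fun n => |γ n - γ (n + 1)|) (hsq : Summable fun n => γ n ^ 2) {s : ℝ}
    (hstep : ∀ n ω, dist (x (n + 1) ω) (x n ω) ≤
      s * |γ (n + 1)| * W (z (n + 1) ω) ^ (1 / 2 : ℝ)) :
    ∀ᵐ ω ∂P, Summable (fun n => γ (n + 1) • (Φ (x n ω) (z (n + 1) ω) -
      ∫ y, Φ (x n ω) y ∂(π (x n ω)))) (.conditional ℕ) := by
  obtain ⟨C, ρ, B, D, hQ⟩ := h.exists_isErgodicFamily hlip hM hπ hMπ
  obtain ⟨c, hc0, hc⟩ := h.exists_norm_le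
  obtain ⟨L, hL0, hL⟩ := hlip.exists_nonneg
  obtain ⟨R, hR⟩ := h.exists_memLp_two hκ H h0
  have hΦ_lip (t t' : K) (z : Z) :
      ‖Φ t z - Φ t' z‖ ≤ L * dist t t' * W z ^ (1 / 2 : ℝ) :=
    norm_le_of_wNorm_le (V := fun z => W z ^ (1 / 2 : ℝ)) (zero_lt_one.trans_le (h.one_le_rpow z))
      (mul_nonneg hL0 dist_nonneg) (hL t t.2 t' t'.2).1
  exact H.ae_summable_smul_noise (V := fun z => W z ^ (1 / 2 : ℝ)) (Φ := fun (t : K) z => Φ t z) hQ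
    hκ hc0 hL0 (fun t => hΦ t t.2) (fun t => hc t t.2) hΦ_lip (fun n => (hR n).1)
    (fun n => (hR n).2) hvar hsq hstep

end Assumptions

end ProxSGD

end

open ProxSGD in
theorem mainTheorem8_general {E Z Ω : Type*} [NormedAddCommGroup E] [InnerProductSpace ℝ E]
    [FiniteDimensional ℝ E] [MeasurableSpace E] [BorelSpace E] [MeasurableSpace Z]
    [MeasurableSpace Ω] (P : Measure Ω) [IsProbabilityMeasure P] (X K : Set E)
    (hK : IsCompact K) (hKX : K ⊆ X) (g : E → ℝ) (hg : LocallyLipschitzOn X g)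
    (hg_bdd : BddBelow (g '' X)) (γ : ℕ → ℝ) (hγ : ∀ k, 1 ≤ k → 0 < γ k)
    (hγ_var : Summable fun k => |γ k - γ (k + 1)|) (hγ_sq : Summable fun k => γ k ^ 2)
    (Φ : E → Z → E) (hΦ : ∀ x ∈ K, Measurable (Φ x)) (M : E → Kernel Z Z) (π : E → Measure Z)
    (hM : ∀ x ∈ K, IsMarkovKernel (M x)) (hπ : ∀ x ∈ K, IsProbabilityMeasure (π x))
    (hMπ : ∀ x ∈ K, Kernel.Invariant (M x) (π x)) (F : E → E)
    (hF : ∀ x ∈ K, F x = ∫ z, Φ x z ∂(π x)) (W : Z → ℝ) (hB1 : UniformlyErgodic K Φ M π W)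
    (hB2 : LipschitzInParameter K Φ M W) (ℱ : Filtration ℕ ‹MeasurableSpace Ω›)
    (x : ℕ → Ω → E) (z : ℕ → Ω → Z) (hz : MarkovianDynamic P ℱ M x z)
    (hW : Integrable (fun ω => W (z 1 ω)) P) (hx0 : ∀ ω, x 0 ω ∈ K)
    (hx : ∀ ω,
      IndicatorProxScheme X K g γ (fun k => x k ω) (fun k => Φ (x (k - 1) ω) (z k ω)) ∨
      ProjectedProxScheme X K g γ (fun k => x k ω) (fun k => Φ (x (k - 1) ω) (z k ω))) :
    ∀ᵐ ω ∂P, SeriesConverges fun k => γ k • (Φ (x (k - 1) ω) (z k ω) - F (x (k - 1) ω)) := by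
  obtain ⟨ω₀⟩ := nonempty_of_isProbabilityMeasure P
  have : Nonempty Z := ⟨z 1 ω₀⟩
  obtain ⟨L, hL0, hL⟩ := exists_sub_le_mul_dist hg hg_bdd hK hKX
  obtain ⟨c, -, hc⟩ := hB1.exists_norm_le
  obtain ⟨κ, _, hκ⟩ := hB1.exists_isMarkovKernel_sectR_eq hB2 hM hπ hMπ
  have hscheme (k : ℕ) (ω : Ω) := mem_and_norm_sub_le_of_proxScheme hL0 hL hKX hγ (hx0 ω) (hx ω) k
  have hchain := hz.isControlledChain (fun k ω => (hscheme k ω).1) hκ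
  have hstep (n : ℕ) (ω : Ω) : dist (x (n + 1 + 1) ω) (x (n + 1) ω) ≤
      4 * (L + c) * |γ (n + 1 + 1)| * W (z (n + 1 + 1) ω) ^ (1 / 2 : ℝ) := by
    have hγn := hγ (n + 1 + 1) (Nat.le_add_left 1 _)
    have hLV := le_mul_of_one_le_right hL0 (hB1.one_le_rpow (z (n + 1 + 1) ω))
    rw [dist_eq_norm]
    calc _ ≤ 4 * γ (n + 1 + 1) * (L + ‖Φ (x (n + 1) ω) (z (n + 1 + 1) ω)‖) := (hscheme (n + 1) ω).2
      _ ≤ 4 * γ (n + 1 + 1) * (L * W (z (n + 1 + 1) ω) ^ (1 / 2 : ℝ) +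
          c * W (z (n + 1 + 1) ω) ^ (1 / 2 : ℝ)) := by
        gcongr
        exact hc _ (hscheme (n + 1) ω).1 _
      _ = _ := by
        rw [abs_of_pos hγn]
        ring
  have hnoise := hB1.ae_summable_smul_noise hB2 hM hπ hMπ hΦ hκ hchain hW
    (γ := fun k => γ (k + 1)) (hγ_var.comp_injective (add_left_injective 1))
    (hγ_sq.comp_injective (add_left_injective 1)) hstep
  filter_upwards [hnoise] with ω hω
  refine seriesConverges_of_summable_conditional ?_
  convert hω using 3 with n
  rw [Nat.add_succ_sub_one, hF _ (hscheme (n + 1) ω).1]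

theorem mainTheorem8 {d : ℕ} {Z Ω : Type*} [MeasurableSpace Z] [MeasurableSpace Ω]
    (P : Measure Ω) [IsProbabilityMeasure P]
    (X K : Set (EuclideanSpace ℝ (Fin d)))
    (hK_ne : K.Nonempty) (hK_compact : IsCompact K) (hK_convex : Convex ℝ K) (hKX : K ⊆ X)
    (f g : EuclideanSpace ℝ (Fin d) → ℝ) (hfg : ProxSGD.CompositeObjective X f g)
    (γ : ℕ → ℝ) (hγ : ProxSGD.StepSizes γ)
    (hγ_var : Summable fun k => |γ k - γ (k + 1)|) (hγ_sq : Summable fun k => γ k ^ 2)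
    (Φ : EuclideanSpace ℝ (Fin d) → Z → EuclideanSpace ℝ (Fin d))
    (hΦ_meas : Measurable fun p : K × Z => Φ p.1 p.2)
    (M : EuclideanSpace ℝ (Fin d) → Kernel Z Z) (π : EuclideanSpace ℝ (Fin d) → Measure Z)
    (hM : ∀ x ∈ X, IsMarkovKernel (M x)) (hπ : ∀ x ∈ X, IsProbabilityMeasure (π x))
    (hMπ : ∀ x ∈ X, Kernel.Invariant (M x) (π x))
    (hΦ_int : ∀ x ∈ K, Integrable (Φ x) (π x))
    (hΦ : ∀ x ∈ K, gradient f x = ∫ z, Φ x z ∂(π x))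
    (W : Z → ℝ) (hB1 : ProxSGD.UniformlyErgodic K Φ M π W)
    (hB2 : ProxSGD.LipschitzInParameter K Φ M W)
    (ℱ : Filtration ℕ ‹MeasurableSpace Ω›)
    (x : ℕ → Ω → EuclideanSpace ℝ (Fin d)) (z : ℕ → Ω → Z)
    (hz : ProxSGD.MarkovianDynamic P ℱ M x z)
    (hW : Integrable (fun ω => W (z 1 ω)) P)
    (hx0 : ∀ ω, x 0 ω ∈ K)
    (hx :
      (∀ ω, ProxSGD.IndicatorProxScheme X K g γ (fun k => x k ω)
        (fun k => Φ (x (k - 1) ω) (z k ω))) ∨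
      (∀ ω, ProxSGD.ProjectedProxScheme X K g γ (fun k => x k ω)
        (fun k => Φ (x (k - 1) ω) (z k ω)))) :
    (∀ᵐ ω ∂P, ProxSGD.NoiseCondition γ
      (fun k => Φ (x (k - 1) ω) (z k ω) - gradient f (x (k - 1) ω))) ∧
    (∀ᵐ ω ∂P, ProxSGD.SeriesConverges
      (fun k => γ k • (Φ (x (k - 1) ω) (z k ω) - gradient f (x (k - 1) ω)))) := by
  have hconv := mainTheorem8_general P X K hK_compact hKX g hfg.locallyLipschitz
    hfg.bddBelow γ hγ.pos hγ_var hγ_sq Φ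
    (fun x hx => hΦ_meas.comp (measurable_const.prodMk measurable_id :
      Measurable fun z : Z => ((⟨x, hx⟩ : K), z)))
    M π (fun x hx => hM x (hKX hx)) (fun x hx => hπ x (hKX hx)) (fun x hx => hMπ x (hKX hx))
    (gradient f) hΦ W hB1 hB2 ℱ x z hz hW hx0
    (fun ω => hx.imp (fun h => h ω) fun h => h ω)
  exact ⟨hconv.mono fun _ h => h.noiseCondition, hconv⟩
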